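/- Let $(G_k,q_k,g_k)_{k\in\mathbb N}$ be a family, indexed by a security parameter $k$, of cyclic groups $G_k=\langle g_k\rangle$ of prime order $q_k$, whose elements are represented by distinct bit strings of a common length bounded by a polynomial in $k$, with multiplication on representations computed by Boolean circuits of polynomial size. An \emph{adversary} is a family of Boolean circuits of polynomial size which, besides their input, get polynomially many uniformly random bits. A function $\varepsilon$ is \emph{negligible} if $k^m\varepsilon(k)\to 0$ for every $m$. The Decisional Diffie--Hellman (DDH) problem is \emph{intractable} in the family if for every adversary $D$ the quantity $$\bigl|\Pr[D(g^a,g^b,g^{ab})=1]-\Pr[D(u,v,w)=1]\bigr|$$ is negligible, where $g=g_k$, $a,b\in\mathbb Z/q_k$ and $u,v,w\in G_k$ are uniform and independent. \emph{The protocols.} There are $n\ge 2$ users $U_1,\dots,U_n$, one of which, $U_c$, is the controller. User $U_i$ holds private keys $r_i,x_i\in\mathbb Z/q$ (sums and products of exponents are taken modulo $q$). In the course of the run the controller draws new private keys $r'_c,x'_c$, which replace $(r_c,x_c)$ after the run. In both protocols the common key is $K=g^{r_c\sum_{j\ne c}r_j}$. Protocol 1. First round: each $U_i$, $i\neq c$,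 publishes $g^{r_i},g^{x_i}$. Second round: each $U_i$, $i\ne c$, sends $g^{\sum_{j\ne c,i}r_j}$ to $U_c$, and $U_c$ broadcasts $Y_1,\dots,Y_n,\ R=g^{r_c},\ S=g^{x_c}$, where $Y_i=g^{-x_cx_i}g^{r_c\sum_{j\neq c,i}r_j}$ for $i\ne c$ and $Y_c=K g^{-r'_cr_c}g^{-x'_cx_c}$. User $U_i$, $i\ne c$, obtains the key as $K=Y_iS^{x_i}R^{r_i}$. Protocol 2. First round: each $U_i$, $i\ne c$, publishes $g^{r_i}$. Second round: each $U_i$, $i\neq c$, sends $g^{\sum_{j\ne c,i}r_j}g^{-x_i}$ to $U_c$, and $U_c$ broadcasts $Y_1,\dots,Y_n,\ R=g^{r_c}$, where $Y_i=g^{r_c\sum_{j\neq c,i}r_j}g^{-r_cx_i}$ for $i\ne c$ and $Y_c=K g^{-r'_cr_c}g^{-x'_cr_c}$. User $U_i$, $i\ne c$, obtains the key as $K=Y_iR^{x_i}R^{r_i}$. \emph{Secrecy.} For each $k$, let $n(k)\ge2$ users run the protocol $T(k)\ge1$ times, where $n$ and $T$ are bounded by polynomials in $k$. All private keys that are drawn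 are uniform and independent. Every user draws private keys before the first run. It is fixed in advance, in an arbitrary way, who is the controller of each run and which users draw new private keys between two consecutive runs; the other users keep the keys they hold. (This includes the case of long-lived keys and the case of independent runs.) The protocol \emph{provides secrecy} if for all such $n$, $T$ and choices, and for every adversary $\mathcal A$, there is a negligible $\varepsilon$ such that for all $k$ the following has probability at most $\frac12+\varepsilon(k)$: $\mathcal A$, given all the messages sent in the $T(k)$ runs together with an element $Z$ of $G_k$, correctly guesses a uniformly random bit $b$, where $Z$ is the key of the last run if $b=1$, and $Z$ is an independent uniformly random element of $G_k$ if $b=0$. \textbf{Theorem.} If the DDH problem is intractable in the family $(G_k,q_k,g_k)$, then Protocols 1 and 2 provide secrecy. -/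

import Mathlib

/-! ### Asymptotics in the security parameter -/

/-- `f` is bounded by a polynomial in the security parameter. -/
def PolyBounded (f : ℕ → ℕ) : Prop :=
  ∃ p : Polynomial ℕ, ∀ k, f k ≤ p.eval k

/-- `ε` is negligible: it decays faster than every inverse power of the security parameter. -/
def Negligible (ε : ℕ → ℝ) : Prop :=
  Asymptotics.SuperpolynomialDecay Filter.atTop (fun k : ℕ => (k : ℝ)) ε

/-- Probability of the event `E` for a uniformly distributed `ω` in the finite set `Ω`. -/
noncomputable def unifProb (Ω : Type) [Fintype Ω] (E : Ω → Bool) : ℝ :=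
  ((Finset.univ.filter fun ω => E ω = true).card : ℝ) / (Fintype.card Ω : ℝ)

/-! ### Boolean circuits

A circuit is a list of NAND gates and a list of output wires.  On an input of length `m`, the
wires `0, …, m - 1` carry the input and the `t`-th gate (counted from `0`) writes wire `m + t`.
A wire that has not been written carries the constant `false`. -/

structure BoolCircuit where
  /-- The gate `(a, b)` computes the NAND of the wires `a` and `b`. -/
  gates : List (ℕ × ℕ)
  /-- The output wires. -/
  outs : List ℕ

/-- Evaluate gates in order; the first of them writes wire `pos`. -/
def runGates : List (ℕ × ℕ) → ℕ → (ℕ → Bool) → (ℕ → Bool)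
  | [], _, w => w
  | (a, b) :: gs, pos, w => runGates gs (pos + 1) (Function.update w pos (!(w a && w b)))

namespace BoolCircuit

/-- The number of gates. -/
def size (C : BoolCircuit) : ℕ := C.gates.length

def eval (C : BoolCircuit) (input : List Bool) : List Bool :=
  C.outs.map (runGates C.gates input.length (fun i => input.getD i false))

/-- The output bit of a circuit that is used as a distinguisher. -/
def decision (C : BoolCircuit) (input : List Bool) : Bool := (C.eval input).headD false

end BoolCircuit

/-- A family of probabilistic circuits of polynomial size: for the security parameter `k`, the
circuit `circuit k` gets `coins k` uniformly random bits after its proper input. -/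
structure PolySizeDistinguisher where
  circuit : ℕ → BoolCircuit
  coins : ℕ → ℕ
  size_poly : PolyBounded fun k => (circuit k).size
  coins_poly : PolyBounded coins

/-- The output bit on the given input and coins. -/
def PolySizeDistinguisher.output (A : PolySizeDistinguisher) (k : ℕ) (input : List Bool)
    (ρ : Fin (A.coins k) → Bool) : Bool :=
  (A.circuit k).decision (input ++ List.ofFn ρ)

/-! ### Groups of prime order -/

/-- A family of cyclic groups `G k` of prime order `q k` with generators `g k`, indexed by the
security parameter.  Group elements are represented by distinct bit strings of a polynomially
bounded common length, and multiplication is feasible on these representations. -/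
structure PrimeOrderGroupFamily where
  G : ℕ → Type
  [group : ∀ k, CommGroup (G k)]
  [fintype : ∀ k, Fintype (G k)]
  q : ℕ → ℕ
  [prime : ∀ k, Fact (q k).Prime]
  card_eq : ∀ k, Fintype.card (G k) = q k
  g : ∀ k, G k
  generates : ∀ k, ∀ x : G k, x ∈ Subgroup.zpowers (g k)
  len : ℕ → ℕ
  len_poly : PolyBounded len
  enc : ∀ k, G k → List Bool
  enc_length : ∀ k, ∀ x : G k, (enc k x).length = len k
  enc_injective : ∀ k, Function.Injective (enc k)
  mul_feasible : ∃ M : ℕ → BoolCircuit, (PolyBounded fun k => (M k).size) ∧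
    ∀ k, ∀ x y : G k, (M k).eval (enc k x ++ enc k y) = enc k (x * y)

namespace PrimeOrderGroupFamily

attribute [instance] PrimeOrderGroupFamily.group PrimeOrderGroupFamily.fintype
  PrimeOrderGroupFamily.prime

variable (𝓖 : PrimeOrderGroupFamily)

/-- `g ^ a` for an exponent `a` modulo the group order. -/
def expo (k : ℕ) (a : ZMod (𝓖.q k)) : 𝓖.G k := 𝓖.g k ^ a.val

/-- Representation of a finite sequence of group elements. -/
def encList (k : ℕ) (l : List (𝓖.G k)) : List Bool := l.flatMap (𝓖.enc k)

/-- Probability that `D` outputs `1` on `(g ^ a, g ^ b, g ^ (a * b))`. -/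
noncomputable def ddhReal (D : PolySizeDistinguisher) (k : ℕ) : ℝ :=
  unifProb (ZMod (𝓖.q k) × ZMod (𝓖.q k) × (Fin (D.coins k) → Bool)) fun ω =>
    D.output k (𝓖.encList k [𝓖.expo k ω.1, 𝓖.expo k ω.2.1, 𝓖.expo k (ω.1 * ω.2.1)]) ω.2.2

/-- Probability that `D` outputs `1` on three independent uniform elements of the group. -/
noncomputable def ddhRandom (D : PolySizeDistinguisher) (k : ℕ) : ℝ :=
  unifProb (𝓖.G k × 𝓖.G k × 𝓖.G k × (Fin (D.coins k) → Bool)) fun ω =>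
    D.output k (𝓖.encList k [ω.1, ω.2.1, ω.2.2.1]) ω.2.2.2

/-- The Decisional Diffie–Hellman problem is intractable in the family. -/
def DDHIntractable : Prop :=
  ∀ D : PolySizeDistinguisher, Negligible fun k => |𝓖.ddhReal D k - 𝓖.ddhRandom D k|

/-! ### The initial key agreement protocols -/

/-- The private keys `(r, x)` of one user. -/
abbrev KeyPair (k : ℕ) : Type := ZMod (𝓖.q k) × ZMod (𝓖.q k)

/-- A key agreement protocol among `n` users, seen from outside.  From the controller `c`, the
private keys of all the users and the new private keys that the controller draws during the run,
it determines the messages sent on the network, in their order, and the common key. -/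
abbrev Protocol : Type :=
  ∀ k n : ℕ, Fin n → (Fin n → 𝓖.KeyPair k) → 𝓖.KeyPair k → List (𝓖.G k) × 𝓖.G k

/-- The users other than the controller. -/
def others {n : ℕ} (c : Fin n) : List (Fin n) := (List.finRange n).filter fun i => i ≠ c

/-- The common key `g ^ (r_c * ∑_{j ≠ c} r_j)` of both protocols. -/
def commonKey (k n : ℕ) (c : Fin n) (keys : Fin n → 𝓖.KeyPair k) : 𝓖.G k :=
  𝓖.expo k ((keys c).1 * ∑ j ∈ Finset.univ.filter (fun j => j ≠ c), (keys j).1)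

/-- The exponent `∑_{j ≠ c, i} r_j`. -/
def partialSum (k n : ℕ) (c i : Fin n) (keys : Fin n → 𝓖.KeyPair k) : ZMod (𝓖.q k) :=
  ∑ j ∈ Finset.univ.filter (fun j => j ≠ c ∧ j ≠ i), (keys j).1

/-- Protocol 1.  The messages are: the public keys `g ^ r_i`, `g ^ x_i` of the users `i ≠ c`;
their second-round messages `g ^ (∑_{j ≠ c, i} r_j)`; and the controller's broadcast
`Y_1, …, Y_n, R, S`. -/
def protocol1 : 𝓖.Protocol := fun k n c keys new =>
  let r : Fin n → ZMod (𝓖.q k) := fun i => (keys i).1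
  let x : Fin n → ZMod (𝓖.q k) := fun i => (keys i).2
  let K := 𝓖.commonKey k n c keys
  let Y : Fin n → 𝓖.G k := fun i =>
    if i = c then K * 𝓖.expo k (-(new.1 * r c)) * 𝓖.expo k (-(new.2 * x c))
    else 𝓖.expo k (-(x c * x i)) * 𝓖.expo k (r c * 𝓖.partialSum k n c i keys)
  ((others c).flatMap (fun i => [𝓖.expo k (r i), 𝓖.expo k (x i)])
    ++ (others c).map (fun i => 𝓖.expo k (𝓖.partialSum k n c i keys))
    ++ (List.finRange n).map Y
    ++ [𝓖.expo k (r c), 𝓖.expo k (x c)], K)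

/-- Protocol 2.  The messages are: the public keys `g ^ r_i` of the users `i ≠ c`; their
second-round messages `g ^ (∑_{j ≠ c, i} r_j) * g ^ (-x_i)`; and the controller's broadcast
`Y_1, …, Y_n, R`. -/
def protocol2 : 𝓖.Protocol := fun k n c keys new =>
  let r : Fin n → ZMod (𝓖.q k) := fun i => (keys i).1
  let x : Fin n → ZMod (𝓖.q k) := fun i => (keys i).2
  let K := 𝓖.commonKey k n c keys
  let Y : Fin n → 𝓖.G k := fun i =>
    if i = c then K * 𝓖.expo k (-(new.1 * r c)) * 𝓖.expo k (-(new.2 * r c))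
    else 𝓖.expo k (r c * 𝓖.partialSum k n c i keys) * 𝓖.expo k (-(r c * x i))
  ((others c).map (fun i => 𝓖.expo k (r i))
    ++ (others c).map (fun i => 𝓖.expo k (𝓖.partialSum k n c i keys) * 𝓖.expo k (-(x i)))
    ++ (List.finRange n).map Y
    ++ [𝓖.expo k (r c)], K)

end PrimeOrderGroupFamily

/-! ### Secrecy against a passive adversary -/

/-- How often and by whom a protocol is run: for each security parameter, `users` many users run
it `runs` many times, `controller k t` is the controller of the `t`-th run, and
`renew k t i` says whether user `i` draws new private keys between the runs `t - 1` and `t`.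
(All users draw their keys before run `0`.) -/
structure RunSchedule where
  users : ℕ → ℕ
  runs : ℕ → ℕ
  users_poly : PolyBounded users
  runs_poly : PolyBounded runs
  two_le_users : ∀ k, 2 ≤ users k
  one_le_runs : ∀ k, 1 ≤ runs k
  controller : ∀ k, ℕ → Fin (users k)
  renew : ∀ k, ℕ → Fin (users k) → Bool

namespace PrimeOrderGroupFamily

variable (𝓖 : PrimeOrderGroupFamily)

/-- The randomness of the users in all the runs: for each run, a new key pair for each user
(used if that user draws new keys before the run), and the new key pair that the controller draws
in the course of the run. -/
abbrev RunCoins (S : RunSchedule) (k : ℕ) : Type :=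
  (Fin (S.runs k) → Fin (S.users k) → 𝓖.KeyPair k) × (Fin (S.runs k) → 𝓖.KeyPair k)

/-- The private keys that the users hold at the start of run `t`.  The pair that the controller
draws in a run replaces his private keys after that run. -/
def keysAt (S : RunSchedule) (k : ℕ) (ω : 𝓖.RunCoins S k) :
    (t : ℕ) → t < S.runs k → Fin (S.users k) → 𝓖.KeyPair k
  | 0, h, i => ω.1 ⟨0, h⟩ i
  | t + 1, h, i =>
    if S.renew k (t + 1) i = true then ω.1 ⟨t + 1, h⟩ i
    else if i = S.controller k t then ω.2 ⟨t, Nat.lt_of_succ_lt h⟩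
    else keysAt S k ω t (Nat.lt_of_succ_lt h) i

/-- Messages and key of run `t`. -/
def runAt (P : 𝓖.Protocol) (S : RunSchedule) (k : ℕ) (ω : 𝓖.RunCoins S k)
    (t : Fin (S.runs k)) : List (𝓖.G k) × 𝓖.G k :=
  P k (S.users k) (S.controller k t) (𝓖.keysAt S k ω t t.isLt) (ω.2 t)

/-- All the messages of all the runs. -/
def transcript (P : 𝓖.Protocol) (S : RunSchedule) (k : ℕ) (ω : 𝓖.RunCoins S k) :
    List (𝓖.G k) :=
  (List.finRange (S.runs k)).flatMap fun t => (𝓖.runAt P S k ω t).1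

/-- The key of the last run. -/
def lastKey (P : 𝓖.Protocol) (S : RunSchedule) (k : ℕ) (ω : 𝓖.RunCoins S k) : 𝓖.G k :=
  (𝓖.runAt P S k ω ⟨S.runs k - 1, Nat.sub_one_lt_of_lt (S.one_le_runs k)⟩).2

/-- Probability that `A` guesses the uniform bit `b`, given the messages of all the runs and
either the key of the last run (if `b` is true) or a uniform element of the group (otherwise). -/
noncomputable def guessProb (P : 𝓖.Protocol) (S : RunSchedule) (A : PolySizeDistinguisher)
    (k : ℕ) : ℝ :=
  unifProb (𝓖.RunCoins S k × 𝓖.G k × Bool × (Fin (A.coins k) → Bool)) fun ω =>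
    let b := ω.2.2.1
    let challenge := if b = true then 𝓖.lastKey P S k ω.1 else ω.2.1
    A.output k (𝓖.encList k (𝓖.transcript P S k ω.1 ++ [challenge])) ω.2.2.2 == b

/-- The protocol guarantees secrecy: no feasible passive adversary that has witnessed polynomially
many runs tells the key of the last run from a random one with probability better than
`1 / 2 + ε`, where `ε` is negligible. -/
def GuaranteesSecrecy (P : 𝓖.Protocol) : Prop :=
  ∀ (S : RunSchedule) (A : PolySizeDistinguisher),
    ∃ ε : ℕ → ℝ, Negligible ε ∧ ∀ k, 𝓖.guessProb P S A k ≤ 1 / 2 + ε k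

end PrimeOrderGroupFamily

/-! Work with exponents: all private keys together form a uniform vector `κ` over `ZMod q`, with one
`Slot` for each pair ever drawn. In the last run the exponent of `Y_i` is a base term minus a mask,
and each mask is a Diffie–Hellman product. Its first factor is a key of the last controller (`x_c`
in Protocol 1, `r_c` in Protocol 2). Its second factor is the `x`-key that user `i` holds after the
run, hence `x'_c` for `i = c`.

DDH replaces one product `a * b` by a random `c`, provided that all the other data are affine in `a,
b, c` once the other keys are fixed: then they can be computed from `g^a, g^b, g^c`. This holds
because controllers change their keys. Every product in an earlier run contains a key of that run's
controller, who has discarded it by the last run, so `a` and `b` enter earlier messages only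
affinely. In the last run the other masks are `a` times keys different from `b`, and the base terms
and the key are `r_c` times sums of fixed `r`-keys.

A hybrid argument over the `n` users makes all masks random (`abs_real_sub_random_le`); the `Y_i`
are then uniform and reveal nothing. Now the key contains `r_c * r_u` for some other user `u`, and
one more DDH step makes it uniform (`abs_lastKey_sub_random_le`). Undoing the first `n` steps with a
random challenge costs `n` more, in total `2n + 1` DDH advantages.

The fixed keys differ from sample to sample, so a bound uniform in them is needed. Circuits are
non-uniform: for each `k` the worst coefficients can be hardwired
(`DDHIntractable.exists_negligible_bound`). The circuit part shows that evaluating the affine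
exponents has polynomial cost. It tracks sets of computable functions instead of wire numbers. -/

/-! ### Straight-line programs over functions -/

/-- From the Boolean functions in `S` one gets those in `S'` by `N` successive NAND gates. -/
inductive NandReach {X : Type*} (S : Set (X → Bool)) : ℕ → Set (X → Bool) → Prop
  | refl : NandReach S 0 S
  | gate {N : ℕ} {S' : Set (X → Bool)} {f g : X → Bool} (h : NandReach S N S')
      (hf : f ∈ S') (hg : g ∈ S') : NandReach S (N + 1) (insert (fun x => !(f x && g x)) S')

namespace NandReach

variable {X : Type*} {S S' S'' : Set (X → Bool)} {N N' : ℕ}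

theorem subset (h : NandReach S N S') : S ⊆ S' := by
  induction h with
  | refl => exact subset_rfl
  | gate _ _ _ ih => exact ih.trans (Set.subset_insert _ _)

theorem trans (h : NandReach S N S') (h' : NandReach S' N' S'') : NandReach S (N + N') S'' := by
  induction h' with
  | refl => exact h
  | gate _ hf hg ih => exact ih.gate hf hg

end NandReach

/-! ### Circuits and straight-line programs -/

theorem runGates_append (gs hs : List (ℕ × ℕ)) (pos : ℕ) (w : ℕ → Bool) :
    runGates (gs ++ hs) pos w = runGates hs (pos + gs.length) (runGates gs pos w) := by
  induction gs generalizing pos w with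
  | nil => rfl
  | cons g gs ih =>
    obtain ⟨a, b⟩ := g
    simp only [List.cons_append, runGates, ih, List.length_cons]
    congr 1
    omega

theorem runGates_of_le (gs : List (ℕ × ℕ)) (pos : ℕ) (w : ℕ → Bool) {i : ℕ}
    (hi : pos + gs.length ≤ i) : runGates gs pos w i = w i := by
  induction gs generalizing pos w with
  | nil => rfl
  | cons g gs ih =>
    obtain ⟨a, b⟩ := g
    simp only [List.length_cons] at hi
    rw [runGates, ih _ _ (by omega), Function.update_of_ne (by omega)]

/-- Every gate adds the function it computes. A wire that is overwritten causes no loss, since sets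
of available functions only grow. -/
theorem NandReach.of_runGates {X : Type*} {S : Set (X → Bool)} (gs : List (ℕ × ℕ)) (pos : ℕ)
    (w : X → ℕ → Bool) (hw : ∀ i, (fun x => w x i) ∈ S) :
    ∃ S', NandReach S gs.length S' ∧ ∀ i, (fun x => runGates gs pos (w x) i) ∈ S' := by
  induction gs generalizing pos w S with
  | nil => exact ⟨S, .refl, hw⟩
  | cons g gs ih =>
    obtain ⟨a, b⟩ := g
    obtain ⟨S', h, hS'⟩ := ih (S := insert (fun x => !(w x a && w x b)) S) (pos + 1)
      (fun x => Function.update (w x) pos (!(w x a && w x b))) (by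
        intro i
        by_cases hi : i = pos
        · subst hi
          simp
        · simpa [Function.update_of_ne hi] using Set.mem_insert_of_mem _ (hw i))
    refine ⟨S', ?_, hS'⟩
    have := (NandReach.refl.gate (hw a) (hw b)).trans h
    rwa [Nat.zero_add, Nat.add_comm] at this

/-- All bits of the bit string `l x` are among the functions in `S`. -/
def BitsIn {X : Type*} (S : Set (X → Bool)) (l : X → List Bool) : Prop :=
  ∀ i, (fun x => (l x).getD i false) ∈ S

namespace BitsIn

variable {X : Type*} {S S' : Set (X → Bool)} {l l' : X → List Bool}

theorem mono (h : BitsIn S l) (hS : S ⊆ S') : BitsIn S' l := fun i => hS (h i)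

theorem append {m : ℕ} (h : BitsIn S l) (h' : BitsIn S l') (hm : ∀ x, (l x).length = m) :
    BitsIn S fun x => l x ++ l' x := by
  intro i
  by_cases hi : i < m
  · convert h i using 2 with x
    exact List.getD_append _ _ _ _ (by rw [hm]; exact hi)
  · convert h' (i - m) using 2 with x
    rw [List.getD_append_right _ _ _ _ (by rw [hm]; omega), hm]

theorem const (hf : (fun _ => false) ∈ S) (ht : (fun _ => true) ∈ S) (b : List Bool) :
    BitsIn S fun _ => b := by
  intro i
  change (fun _ => b.getD i false) ∈ S
  cases b.getD i false
  · exact hf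
  · exact ht

theorem of_append_left {m : ℕ} (hf : (fun _ => false) ∈ S) (hm : ∀ x, (l x).length = m)
    (h : BitsIn S fun x => l x ++ l' x) : BitsIn S l := by
  intro i
  by_cases hi : i < m
  · convert h i using 2 with x
    exact (List.getD_append _ _ _ _ (by rw [hm]; exact hi)).symm
  · convert hf using 2 with x
    exact List.getD_eq_default _ _ (by rw [hm]; omega)

theorem of_append_right {m : ℕ} (hm : ∀ x, (l x).length = m)
    (h : BitsIn S fun x => l x ++ l' x) : BitsIn S l' := by
  intro i
  convert h (m + i) using 2 with x
  rw [List.getD_append_right _ _ _ _ (by rw [hm]; omega), hm, Nat.add_sub_cancel_left]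

/-- A circuit can be applied to strings whose bits are available. -/
theorem eval (C : BoolCircuit) {m : ℕ} (h : BitsIn S l) (hm : ∀ x, (l x).length = m) :
    ∃ S', NandReach S C.size S' ∧ (∀ o, (fun x =>
      runGates C.gates (l x).length (fun i => (l x).getD i false) o) ∈ S') := by
  simp only [hm]
  exact NandReach.of_runGates C.gates m (fun x i => (l x).getD i false) h

theorem bitsIn_eval (C : BoolCircuit) {m : ℕ} (hf : (fun _ => false) ∈ S) (h : BitsIn S l)
    (hm : ∀ x, (l x).length = m) :
    ∃ S', NandReach S C.size S' ∧ BitsIn S' fun x => C.eval (l x) := by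
  obtain ⟨S', hS, hS'⟩ := h.eval C hm
  refine ⟨S', hS, fun i => ?_⟩
  by_cases hi : i < C.outs.length
  · convert hS' (C.outs[i]) using 2 with x
    rw [List.getD_eq_getElem _ _ (by simpa [BoolCircuit.eval] using hi)]
    simp [BoolCircuit.eval]
  · convert hS.subset hf using 2 with x
    exact List.getD_eq_default _ _ (by simp [BoolCircuit.eval]; omega)

theorem decision (C : BoolCircuit) {m : ℕ} (hf : (fun _ => false) ∈ S) (h : BitsIn S l)
    (hm : ∀ x, (l x).length = m) :
    ∃ S', NandReach S C.size S' ∧ (fun x => C.decision (l x)) ∈ S' := by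
  obtain ⟨S', hS, hS'⟩ := h.bitsIn_eval C hf hm
  refine ⟨S', hS, ?_⟩
  convert hS' 0 using 2 with x
  rw [BoolCircuit.decision, List.headD_eq_getD, List.getD_eq_getElem?_getD]

end BitsIn

/-- The constant function `false` and the input bits. -/
def inputBits {X : Type*} (l : X → List Bool) : Set (X → Bool) :=
  insert (fun _ => false) (Set.range fun i x => (l x).getD i false)

theorem bitsIn_inputBits {X : Type*} (l : X → List Bool) : BitsIn (inputBits l) l :=
  fun i => Set.mem_insert_of_mem _ ⟨i, rfl⟩

/-- Reached functions are placed on wires in the order of their gates. The constant `false` is kept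
as a separate case: it lives on unwritten wires, and a later gate may write any particular one of
them. -/
theorem NandReach.exists_gates {X : Type*} {l : X → List Bool} {m N : ℕ} {S : Set (X → Bool)}
    (hm : ∀ x, (l x).length = m) (h : NandReach (inputBits l) N S) :
    ∃ gs : List (ℕ × ℕ), gs.length = N ∧ ∀ f ∈ S, f = (fun _ => false) ∨ ∃ i < m + N, ∀ x,
      runGates gs m (fun i => (l x).getD i false) i = f x := by
  induction h with
  | refl =>
    refine ⟨[], rfl, ?_⟩
    rintro f (rfl | ⟨i, rfl⟩)
    · exact .inl rfl
    · by_cases hi : i < m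
      · exact .inr ⟨i, hi, fun _ => rfl⟩
      · refine .inl (funext fun x => List.getD_eq_default _ _ ?_)
        rw [hm]
        omega
  | @gate N S f g _ hf hg ih =>
    obtain ⟨gs, hN, ih⟩ := ih
    have key : ∀ f ∈ S, ∃ i, ∀ x, runGates gs m (fun i => (l x).getD i false) i = f x := by
      intro f hf
      rcases ih f hf with rfl | ⟨i, _, hi⟩
      -- The wire that the next gate is about to write still carries `false` when that gate reads
      -- its inputs.
      · refine ⟨m + N, fun x => ?_⟩
        rw [runGates_of_le _ _ _ (by omega), List.getD_eq_default _ _ (by rw [hm]; omega)]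
      · exact ⟨i, hi⟩
    obtain ⟨a, ha⟩ := key f hf
    obtain ⟨b, hb⟩ := key g hg
    refine ⟨gs ++ [(a, b)], by simp [hN], ?_⟩
    rintro e (rfl | he)
    · refine .inr ⟨m + N, by omega, fun x => ?_⟩
      rw [runGates_append]
      simp only [runGates, hN, Function.update_self, ha, hb]
    · refine (ih e he).imp_right ?_
      rintro ⟨i, hi, hx⟩
      refine ⟨i, by omega, fun x => ?_⟩
      rw [runGates_append]
      simp only [runGates, hN]
      rw [Function.update_of_ne (by omega), hx]

theorem NandReach.exists_circuit {X : Type*} {l : X → List Bool} {m N : ℕ} {S : Set (X → Bool)}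
    (hm : ∀ x, (l x).length = m) (h : NandReach (inputBits l) N S) {f : X → Bool} (hf : f ∈ S) :
    ∃ C : BoolCircuit, C.size = N ∧ ∀ x, C.decision (l x) = f x := by
  obtain ⟨gs, hN, hgs⟩ := h.exists_gates hm
  rcases hgs f hf with rfl | ⟨i, _, hi⟩
  -- With no output wire, `decision` takes its default value `false`.
  · refine ⟨⟨gs, []⟩, hN, fun x => rfl⟩
  · refine ⟨⟨gs, [i]⟩, hN, fun x => ?_⟩
    simpa [BoolCircuit.decision, BoolCircuit.eval, hm] using hi x

/-! ### Feasible computations in the group -/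

namespace PrimeOrderGroupFamily

variable (𝓖 : PrimeOrderGroupFamily)

/-- Distinct elements have distinct codes, so exponents have at most `len k` binary digits. This
keeps square-and-multiply polynomial. -/
theorem q_le_two_pow_len (k : ℕ) : 𝓖.q k ≤ 2 ^ 𝓖.len k := by
  rw [← 𝓖.card_eq]
  have := Fintype.card_le_of_injective (β := List.Vector Bool (𝓖.len k))
    (fun x : 𝓖.G k => (⟨𝓖.enc k x, 𝓖.enc_length k x⟩))
    (fun x y h => 𝓖.enc_injective k (congrArg Subtype.val h))
  simpa [card_vector] using this

variable {𝓖} {k : ℕ} {X : Type*} {S : Set (X → Bool)} {M : BoolCircuit}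

theorem bitsIn_mul
    (hM : ∀ x y : 𝓖.G k, M.eval (𝓖.enc k x ++ 𝓖.enc k y) = 𝓖.enc k (x * y))
    (hf : (fun _ => false) ∈ S) {u v : X → 𝓖.G k} (hu : BitsIn S fun x => 𝓖.enc k (u x))
    (hv : BitsIn S fun x => 𝓖.enc k (v x)) :
    ∃ S', NandReach S M.size S' ∧ BitsIn S' fun x => 𝓖.enc k (u x * v x) := by
  obtain ⟨S', hS, h⟩ := (hu.append hv fun x => 𝓖.enc_length k _).bitsIn_eval M
    (m := 𝓖.len k + 𝓖.len k) hf (fun x => by simp [𝓖.enc_length])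
  exact ⟨S', hS, by simpa only [hM] using h⟩

/-- Square and multiply. -/
theorem bitsIn_pow
    (hM : ∀ x y : 𝓖.G k, M.eval (𝓖.enc k x ++ 𝓖.enc k y) = 𝓖.enc k (x * y))
    (hf : (fun _ => false) ∈ S) (ht : (fun _ => true) ∈ S) {u : X → 𝓖.G k}
    (hu : BitsIn S fun x => 𝓖.enc k (u x)) (l n : ℕ) (hn : n < 2 ^ l) :
    ∃ S', NandReach S (2 * l * M.size) S' ∧ BitsIn S' fun x => 𝓖.enc k (u x ^ n) := by
  induction l generalizing n with
  | zero =>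
    obtain rfl : n = 0 := by simpa using hn
    refine ⟨S, by simpa using NandReach.refl, ?_⟩
    simpa using BitsIn.const hf ht (𝓖.enc k 1)
  | succ l ih =>
    obtain ⟨S₁, h₁, b₁⟩ := ih (n / 2) (by rw [pow_succ] at hn; omega)
    obtain ⟨S₂, h₂, b₂⟩ := bitsIn_mul hM (h₁.subset hf) b₁ b₁
    have h₁₂ := h₁.trans h₂
    have b : BitsIn S₂ fun x => 𝓖.enc k (u x ^ (n % 2)) := by
      rcases Nat.mod_two_eq_zero_or_one n with h | h
      · simpa [h] using BitsIn.const (h₁₂.subset hf) (h₁₂.subset ht) (𝓖.enc k 1)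
      · simpa [h] using hu.mono h₁₂.subset
    obtain ⟨S₃, h₃, b₃⟩ := bitsIn_mul hM (h₁₂.subset hf) b₂ b
    refine ⟨S₃, ?_, ?_⟩
    · convert h₁₂.trans h₃ using 1
      ring
    · convert b₃ using 3 with x
      rw [← pow_add, ← pow_add]
      congr 1
      omega

/-- The element `g ^ δ * u ^ α * v ^ β * w ^ γ` for `s = (δ, α, β, γ)`. -/
def word (s : ZMod (𝓖.q k) × ZMod (𝓖.q k) × ZMod (𝓖.q k) × ZMod (𝓖.q k)) (u v w : 𝓖.G k) :
    𝓖.G k :=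
  𝓖.expo k s.1 * u ^ s.2.1.val * v ^ s.2.2.1.val * w ^ s.2.2.2.val

theorem bitsIn_word
    (hM : ∀ x y : 𝓖.G k, M.eval (𝓖.enc k x ++ 𝓖.enc k y) = 𝓖.enc k (x * y))
    (hf : (fun _ => false) ∈ S) (ht : (fun _ => true) ∈ S) {u v w : X → 𝓖.G k}
    (hu : BitsIn S fun x => 𝓖.enc k (u x)) (hv : BitsIn S fun x => 𝓖.enc k (v x))
    (hw : BitsIn S fun x => 𝓖.enc k (w x))
    (s : ZMod (𝓖.q k) × ZMod (𝓖.q k) × ZMod (𝓖.q k) × ZMod (𝓖.q k)) :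
    ∃ S', NandReach S ((6 * 𝓖.len k + 3) * M.size) S' ∧
      BitsIn S' fun x => 𝓖.enc k (word s (u x) (v x) (w x)) := by
  have hlt (a : ZMod (𝓖.q k)) : a.val < 2 ^ 𝓖.len k :=
    (ZMod.val_lt a).trans_le (𝓖.q_le_two_pow_len k)
  obtain ⟨S₁, h₁, b₁⟩ := bitsIn_pow hM hf ht hu _ _ (hlt s.2.1)
  obtain ⟨S₂, h₂, b₂⟩ := bitsIn_pow hM (h₁.subset hf) (h₁.subset ht) (hv.mono h₁.subset) _ _
    (hlt s.2.2.1)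
  have h₁₂ := h₁.trans h₂
  obtain ⟨S₃, h₃, b₃⟩ := bitsIn_pow hM (h₁₂.subset hf) (h₁₂.subset ht) (hw.mono h₁₂.subset) _ _
    (hlt s.2.2.2)
  have h₁₃ := h₁₂.trans h₃
  obtain ⟨S₄, h₄, b₄⟩ := bitsIn_mul hM (h₁₃.subset hf)
    (BitsIn.const (h₁₃.subset hf) (h₁₃.subset ht) (𝓖.enc k (𝓖.expo k s.1)))
    (b₁.mono (h₂.trans h₃).subset)
  have h₁₄ := h₁₃.trans h₄
  obtain ⟨S₅, h₅, b₅⟩ := bitsIn_mul hM (h₁₄.subset hf) b₄ (b₂.mono (h₃.trans h₄).subset)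
  have h₁₅ := h₁₄.trans h₅
  obtain ⟨S₆, h₆, b₆⟩ := bitsIn_mul hM (h₁₅.subset hf) b₅ (b₃.mono (h₄.trans h₅).subset)
  refine ⟨S₆, ?_, b₆⟩
  convert h₁₅.trans h₆ using 1
  ring

theorem encList_length (l : List (𝓖.G k)) :
    (𝓖.encList k l).length = l.length * 𝓖.len k := by
  simp [encList, List.length_flatMap, 𝓖.enc_length]

theorem bitsIn_words
    (hM : ∀ x y : 𝓖.G k, M.eval (𝓖.enc k x ++ 𝓖.enc k y) = 𝓖.enc k (x * y))
    (hf : (fun _ => false) ∈ S) (ht : (fun _ => true) ∈ S) {u v w : X → 𝓖.G k}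
    (hu : BitsIn S fun x => 𝓖.enc k (u x)) (hv : BitsIn S fun x => 𝓖.enc k (v x))
    (hw : BitsIn S fun x => 𝓖.enc k (w x))
    (σ : List (ZMod (𝓖.q k) × ZMod (𝓖.q k) × ZMod (𝓖.q k) × ZMod (𝓖.q k))) :
    ∃ S', NandReach S (σ.length * ((6 * 𝓖.len k + 3) * M.size)) S' ∧
      BitsIn S' fun x => 𝓖.encList k (σ.map fun s => word s (u x) (v x) (w x)) := by
  induction σ with
  | nil => exact ⟨S, by simpa using NandReach.refl, fun _ => hf⟩
  | cons s σ ih =>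
    obtain ⟨S₁, h₁, b₁⟩ := ih
    obtain ⟨S₂, h₂, b₂⟩ := bitsIn_word hM (h₁.subset hf) (h₁.subset ht) (hu.mono h₁.subset)
      (hv.mono h₁.subset) (hw.mono h₁.subset) s
    refine ⟨S₂, ?_, ?_⟩
    · convert h₁.trans h₂ using 1
      simp [add_mul]
    · exact b₂.append (b₁.mono h₂.subset) fun x => 𝓖.enc_length k _

/-- A circuit that maps three group elements to a list of words in them and runs a given circuit
on the result. -/
theorem exists_circuit_words
    (hM : ∀ x y : 𝓖.G k, M.eval (𝓖.enc k x ++ 𝓖.enc k y) = 𝓖.enc k (x * y)) (C : BoolCircuit)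
    (m : ℕ) (σ : List (ZMod (𝓖.q k) × ZMod (𝓖.q k) × ZMod (𝓖.q k) × ZMod (𝓖.q k))) :
    ∃ D : BoolCircuit, D.size = 1 + σ.length * ((6 * 𝓖.len k + 3) * M.size) + C.size ∧
      ∀ (u v w : 𝓖.G k) (ρ : Fin m → Bool),
        D.decision (𝓖.encList k [u, v, w] ++ List.ofFn ρ) =
          C.decision (𝓖.encList k (σ.map fun s => word s u v w) ++ List.ofFn ρ) := by
  let l : 𝓖.G k × 𝓖.G k × 𝓖.G k × (Fin m → Bool) → List Bool := fun x =>
    𝓖.enc k x.1 ++ (𝓖.enc k x.2.1 ++ (𝓖.enc k x.2.2.1 ++ List.ofFn x.2.2.2))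
  have hf₀ : (fun _ => false) ∈ inputBits l := Set.mem_insert _ _
  -- The NAND of `false` with itself supplies the constant `true`, needed to hardwire bits; this
  -- gate is the `1` in the size.
  have h₀ := NandReach.refl.gate hf₀ hf₀
  have hf := h₀.subset hf₀
  have hl := (bitsIn_inputBits l).mono h₀.subset
  have hu := hl.of_append_left hf fun x => 𝓖.enc_length k _
  have hl₁ := hl.of_append_right fun x => 𝓖.enc_length k _
  have hv := hl₁.of_append_left hf fun x => 𝓖.enc_length k _
  have hl₂ := hl₁.of_append_right fun x => 𝓖.enc_length k _
  have hw := hl₂.of_append_left hf fun x => 𝓖.enc_length k _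
  have hρ := hl₂.of_append_right fun x => 𝓖.enc_length k _
  obtain ⟨S₁, h₁, b₁⟩ := bitsIn_words hM hf (Set.mem_insert _ _) hu hv hw σ
  obtain ⟨S₂, h₂, b₂⟩ := (b₁.append (hρ.mono h₁.subset)
    (m := σ.length * 𝓖.len k) (fun x => by simp [encList_length])).decision C (h₁.subset hf)
    (m := σ.length * 𝓖.len k + m) (by simp [encList_length])
  obtain ⟨D, hD, h⟩ := ((h₀.trans h₁).trans h₂).exists_circuit
    (m := 𝓖.len k + (𝓖.len k + (𝓖.len k + m))) (by simp [l, 𝓖.enc_length]) b₂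
  refine ⟨D, by omega, fun u v w ρ => ?_⟩
  rw [← h (u, v, w, ρ)]
  simp [l, encList]

end PrimeOrderGroupFamily

/-! ### Polynomial bounds -/

theorem PolyBounded.mono {f g : ℕ → ℕ} (hg : PolyBounded g) (h : ∀ k, f k ≤ g k) :
    PolyBounded f :=
  let ⟨p, hp⟩ := hg
  ⟨p, fun k => (h k).trans (hp k)⟩

theorem PolyBounded.const (c : ℕ) : PolyBounded fun _ => c :=
  ⟨Polynomial.C c, fun k => by simp⟩

theorem PolyBounded.add {f g : ℕ → ℕ} (hf : PolyBounded f) (hg : PolyBounded g) :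
    PolyBounded fun k => f k + g k := by
  obtain ⟨p, hp⟩ := hf
  obtain ⟨r, hr⟩ := hg
  exact ⟨p + r, fun k => by simpa using add_le_add (hp k) (hr k)⟩

theorem PolyBounded.mul {f g : ℕ → ℕ} (hf : PolyBounded f) (hg : PolyBounded g) :
    PolyBounded fun k => f k * g k := by
  obtain ⟨p, hp⟩ := hf
  obtain ⟨r, hr⟩ := hg
  exact ⟨p * r, fun k => by simpa using Nat.mul_le_mul (hp k) (hr k)⟩

theorem Negligible.polyBounded_mul {ε : ℕ → ℝ} (hε : Negligible ε) {f : ℕ → ℕ}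
    (hf : PolyBounded f) : Negligible fun k => f k * ε k := by
  obtain ⟨p, hp⟩ := hf
  refine (hε.polynomial_mul (p.map (Nat.castRingHom ℝ))).trans_abs_le fun k => ?_
  have hk : (p.map (Nat.castRingHom ℝ)).eval (k : ℝ) = (p.eval k : ℕ) := by
    rw [Polynomial.eval_natCast_map]
    rfl
  simp only [hk, abs_mul, Nat.abs_cast]
  exact mul_le_mul_of_nonneg_right (Nat.cast_le.2 (hp k)) (abs_nonneg _)

/-! ### Averages -/

open scoped BigOperators

theorem Fintype.expect_prod_type {α β : Type*} [Fintype α] [Fintype β] (f : α × β → ℝ) :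
    𝔼 x, f x = 𝔼 a, 𝔼 b, f (a, b) := by
  rw [← Finset.univ_product_univ, Finset.expect_product]

theorem unifProb_eq_expect (Ω : Type) [Fintype Ω] (E : Ω → Bool) :
    unifProb Ω E = 𝔼 ω, if E ω = true then (1 : ℝ) else 0 := by
  rw [Fintype.expect_eq_sum_div_card, unifProb]
  simp

theorem abs_expect_sub_expect_le {ι : Type*} [Fintype ι] [Nonempty ι] {f g : ι → ℝ} {B : ℝ}
    (h : ∀ i, |f i - g i| ≤ B) : |𝔼 i, f i - 𝔼 i, g i| ≤ B := by
  rw [← Finset.expect_sub_distrib]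
  refine (Finset.abs_expect_le _ _).trans ?_
  exact Finset.expect_le Finset.univ_nonempty fun i _ => h i

/-- Drawing one coordinate of a uniform vector anew does not change the distribution. -/
theorem expect_update {V R : Type*} [Fintype V] [DecidableEq V] [Fintype R] [Nonempty R]
    (i : V) (f : (V → R) → ℝ) : 𝔼 κ, 𝔼 a, f (Function.update κ i a) = 𝔼 κ, f κ := by
  -- Exchanging the coordinate with the fresh sample is an involution, hence preserves the uniform
  -- distribution.
  have hinv : Function.Involutive fun x : (V → R) × R => (Function.update x.1 i x.2, x.1 i) := by
    intro x
    simp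
  calc 𝔼 κ, 𝔼 a, f (Function.update κ i a)
      = 𝔼 x : (V → R) × R, f (Function.update x.1 i x.2) :=
        (Fintype.expect_prod_type fun x : (V → R) × R => f (Function.update x.1 i x.2)).symm
    _ = 𝔼 x : (V → R) × R, f x.1 := Fintype.expect_bijective _ hinv.bijective _ _ fun _ => rfl
    _ = 𝔼 κ, f κ := by
        rw [Fintype.expect_prod_type]
        simp only [Fintype.expect_const]

/-! ### Reduction to the Diffie–Hellman problem -/

/-- The values of a list of affine functions, given by their coefficients. -/
def affEval {R : Type*} [CommRing R] (σ : List (R × R × R × R)) (a b c : R) : List R :=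
  σ.map fun s => s.1 + s.2.1 * a + s.2.2.1 * b + s.2.2.2 * c

namespace PrimeOrderGroupFamily

variable (𝓖 : PrimeOrderGroupFamily) (k : ℕ)

theorem pow_q (x : 𝓖.G k) : x ^ 𝓖.q k = 1 := by
  rw [← 𝓖.card_eq]
  exact pow_card_eq_one

theorem expo_natCast (n : ℕ) : 𝓖.expo k n = 𝓖.g k ^ n := by
  rw [expo, ZMod.val_natCast]
  exact (pow_eq_pow_mod n (𝓖.pow_q k _)).symm

theorem expo_add (a b : ZMod (𝓖.q k)) : 𝓖.expo k (a + b) = 𝓖.expo k a * 𝓖.expo k b := by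
  rw [← ZMod.natCast_zmod_val a, ← ZMod.natCast_zmod_val b, ← Nat.cast_add]
  simp only [expo_natCast, pow_add]

theorem expo_mul (a b : ZMod (𝓖.q k)) : 𝓖.expo k (a * b) = 𝓖.expo k b ^ a.val := by
  rw [← ZMod.natCast_zmod_val a, ← ZMod.natCast_zmod_val b, ← Nat.cast_mul]
  simp only [expo_natCast]
  rw [ZMod.natCast_zmod_val, mul_comm, pow_mul]

theorem expo_bijective : Function.Bijective (𝓖.expo k) := by
  rw [Fintype.bijective_iff_surjective_and_card, ZMod.card, 𝓖.card_eq]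
  refine ⟨fun x => ?_, rfl⟩
  obtain ⟨n, rfl⟩ := (mem_powers_iff_mem_zpowers (x := 𝓖.g k)).2 (𝓖.generates k x)
  exact ⟨n, 𝓖.expo_natCast k n⟩

/-- This is how the reduction simulates a transcript: affine exponents become words in the three
challenge elements. -/
theorem map_expo_affEval
    (σ : List (ZMod (𝓖.q k) × ZMod (𝓖.q k) × ZMod (𝓖.q k) × ZMod (𝓖.q k)))
    (a b c : ZMod (𝓖.q k)) : (affEval σ a b c).map (𝓖.expo k) =
      σ.map fun s => word s (𝓖.expo k a) (𝓖.expo k b) (𝓖.expo k c) := by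
  simp [affEval, word, expo_add, expo_mul]

/-- Probability that `A` outputs `1` on the group elements with the given exponents. -/
noncomputable def acceptProb (A : PolySizeDistinguisher) (l : List (ZMod (𝓖.q k))) : ℝ :=
  𝔼 ρ, if A.output k (𝓖.encList k (l.map (𝓖.expo k))) ρ = true then 1 else 0

/-- Advantage of `A` in telling `a * b` from a random `c`, if it is given the group elements
whose exponents are the given affine functions of `a`, `b` and `a * b` or `c`. -/
noncomputable def affAdvantage (A : PolySizeDistinguisher)
    (σ : List (ZMod (𝓖.q k) × ZMod (𝓖.q k) × ZMod (𝓖.q k) × ZMod (𝓖.q k))) : ℝ :=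
  |𝔼 a, 𝔼 b, 𝓖.acceptProb k A (affEval σ a b (a * b)) -
    𝔼 a, 𝔼 b, 𝔼 c, 𝓖.acceptProb k A (affEval σ a b c)|

variable {𝓖}

/-- Hardwire the coefficients and feed the resulting words to `A`: this is a DDH distinguisher of
polynomial size with the same advantage. No uniformity in `k` is required of `σ`. -/
theorem DDHIntractable.negligible_affAdvantage (h : 𝓖.DDHIntractable)
    (A : PolySizeDistinguisher)
    (σ : ∀ k, List (ZMod (𝓖.q k) × ZMod (𝓖.q k) × ZMod (𝓖.q k) × ZMod (𝓖.q k)))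
    (hσ : PolyBounded fun k => (σ k).length) :
    Negligible fun k => 𝓖.affAdvantage k A (σ k) := by
  obtain ⟨M, hM, hmul⟩ := 𝓖.mul_feasible
  choose D hD hDA using fun k =>
    exists_circuit_words (hmul k) (A.circuit k) (A.coins k) (σ k)
  let B : PolySizeDistinguisher :=
    { circuit := D
      coins := A.coins
      size_poly := by
        simp only [hD]
        exact ((PolyBounded.const 1).add (hσ.mul
          ((((PolyBounded.const 6).mul 𝓖.len_poly).add (.const 3)).mul hM))).add A.size_poly
      coins_poly := A.coins_poly }
  have hB (k a b c) : (𝔼 ρ, if B.output k (𝓖.encList k [𝓖.expo k a, 𝓖.expo k b, 𝓖.expo k c]) ρ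
      = true then (1 : ℝ) else 0) = 𝓖.acceptProb k A (affEval (σ k) a b c) := by
    unfold acceptProb
    rw [map_expo_affEval]
    simp only [PolySizeDistinguisher.output, B, hDA]
    rfl
  have hreal (k) : 𝓖.ddhReal B k = 𝔼 a, 𝔼 b, 𝓖.acceptProb k A (affEval (σ k) a b (a * b)) := by
    rw [ddhReal, unifProb_eq_expect]
    simp only [Fintype.expect_prod_type, hB]
  have hrandom (k) :
      𝓖.ddhRandom B k = 𝔼 a, 𝔼 b, 𝔼 c, 𝓖.acceptProb k A (affEval (σ k) a b c) := by
    have he (f : 𝓖.G k → ℝ) : 𝔼 x, f x = 𝔼 a, f (𝓖.expo k a) :=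
      (Fintype.expect_bijective _ (𝓖.expo_bijective k) _ _ fun _ => rfl).symm
    rw [ddhRandom, unifProb_eq_expect]
    simp only [Fintype.expect_prod_type, he, hB]
  refine (h B).congr fun k => ?_
  rw [hreal, hrandom, affAdvantage]

/-- For lists of a polynomially bounded length the largest advantage is negligible. -/
theorem DDHIntractable.exists_negligible_bound (h : 𝓖.DDHIntractable)
    (A : PolySizeDistinguisher) {L : ℕ → ℕ} (hL : PolyBounded L) :
    ∃ ε : ℕ → ℝ, Negligible ε ∧ ∀ k,
      ∀ σ : List (ZMod (𝓖.q k) × ZMod (𝓖.q k) × ZMod (𝓖.q k) × ZMod (𝓖.q k)),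
        σ.length ≤ L k → 𝓖.affAdvantage k A σ ≤ ε k := by
  -- Over a finite ring there are finitely many lists of bounded length, so for each `k` a worst one
  -- exists; the family of worst lists is itself admissible.
  have hmax (k) := Set.exists_max_image
    {σ : List (ZMod (𝓖.q k) × ZMod (𝓖.q k) × ZMod (𝓖.q k) × ZMod (𝓖.q k)) | σ.length ≤ L k}
    (𝓖.affAdvantage k A) (List.finite_length_le _ _) ⟨[], by simp⟩
  choose σ hσ hmax using hmax
  exact ⟨_, h.negligible_affAdvantage A σ (hL.mono hσ), hmax⟩

end PrimeOrderGroupFamily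

/-! ### Affine dependence -/

/-- `f` is an affine function of its arguments. -/
def IsAff {R : Type*} [CommRing R] (f : R → R → R → R) : Prop :=
  ∃ s : R × R × R × R, ∀ a b c, f a b c = s.1 + s.2.1 * a + s.2.2.1 * b + s.2.2.2 * c

/-- `f` is a constant function. -/
def IsCst {R : Type*} (f : R → R → R → R) : Prop := ∃ d, ∀ a b c, f a b c = d

/-- `f` is a list of affine functions. -/
def IsAffList {R : Type*} [CommRing R] (f : R → R → R → List R) : Prop :=
  ∃ σ, ∀ a b c, f a b c = affEval σ a b c

section Affine

variable {R : Type*} [CommRing R] {f g : R → R → R → R} {ι : Type*}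

theorem IsCst.isAff (hf : IsCst f) : IsAff f :=
  let ⟨d, hd⟩ := hf
  ⟨(d, 0, 0, 0), fun a b c => by simp [hd]⟩

theorem IsAff.add (hf : IsAff f) (hg : IsAff g) : IsAff fun a b c => f a b c + g a b c := by
  obtain ⟨s, hs⟩ := hf
  obtain ⟨t, ht⟩ := hg
  exact ⟨s + t, fun a b c => by simp only [hs, ht, Prod.fst_add, Prod.snd_add]; ring⟩

theorem IsCst.mul_isAff (hf : IsCst f) (hg : IsAff g) : IsAff fun a b c => f a b c * g a b c := by
  obtain ⟨d, hd⟩ := hf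
  obtain ⟨t, ht⟩ := hg
  refine ⟨(d * t.1, d * t.2.1, d * t.2.2.1, d * t.2.2.2), fun a b c => ?_⟩
  simp only [hd, ht]
  ring

theorem IsAff.mul_isCst (hf : IsAff f) (hg : IsCst g) : IsAff fun a b c => f a b c * g a b c := by
  simpa only [mul_comm] using hg.mul_isAff hf

theorem IsAff.sub (hf : IsAff f) (hg : IsAff g) : IsAff fun a b c => f a b c - g a b c := by
  have : IsCst fun _ _ _ : R => (-1 : R) := ⟨-1, fun _ _ _ => rfl⟩
  simpa [sub_eq_add_neg] using hf.add (this.mul_isAff hg)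

theorem IsAff.sum {f : ι → R → R → R → R} (s : Finset ι) (hf : ∀ i ∈ s, IsAff (f i)) :
    IsAff fun a b c => ∑ i ∈ s, f i a b c := by
  classical
  induction s using Finset.induction_on with
  | empty => exact ⟨0, fun _ _ _ => by simp⟩
  | insert i s hi ih =>
    simp only [Finset.sum_insert hi]
    exact (hf i (by simp)).add (ih fun j hj => hf j (by simp [hj]))

theorem IsCst.sum {f : ι → R → R → R → R} (s : Finset ι) (hf : ∀ i ∈ s, IsCst (f i)) :
    IsCst fun a b c => ∑ i ∈ s, f i a b c := by
  choose! d hd using hf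
  exact ⟨∑ i ∈ s, d i, fun a b c => Finset.sum_congr rfl fun i hi => hd i hi a b c⟩

theorem isAff_fst : IsAff fun a _ _ : R => a := ⟨(0, 1, 0, 0), fun _ _ _ => by simp⟩

theorem isAff_snd : IsAff fun _ b _ : R => b := ⟨(0, 0, 1, 0), fun _ _ _ => by simp⟩

theorem isAff_thd : IsAff fun _ _ c : R => c := ⟨(0, 0, 0, 1), fun _ _ _ => by simp⟩

theorem IsAffList.nil : IsAffList fun _ _ _ : R => ([] : List R) := ⟨[], fun _ _ _ => rfl⟩

theorem IsAffList.cons {l : R → R → R → List R} (hf : IsAff f) (hl : IsAffList l) :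
    IsAffList fun a b c => f a b c :: l a b c := by
  obtain ⟨s, hs⟩ := hf
  obtain ⟨σ, hσ⟩ := hl
  exact ⟨s :: σ, fun a b c => by simp [hs, hσ, affEval]⟩

theorem IsAffList.append {l l' : R → R → R → List R} (hl : IsAffList l) (hl' : IsAffList l') :
    IsAffList fun a b c => l a b c ++ l' a b c := by
  obtain ⟨σ, hσ⟩ := hl
  obtain ⟨τ, hτ⟩ := hl'
  exact ⟨σ ++ τ, fun a b c => by simp [hσ, hτ, affEval]⟩

theorem IsAffList.flatMap {l : ι → R → R → R → List R} (s : List ι)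
    (hl : ∀ i ∈ s, IsAffList (l i)) : IsAffList fun a b c => s.flatMap fun i => l i a b c := by
  induction s with
  | nil => exact .nil
  | cons i s ih =>
    simp only [List.flatMap_cons]
    exact (hl i (by simp)).append (ih fun j hj => hl j (by simp [hj]))

theorem IsAffList.map {f : ι → R → R → R → R} (s : List ι) (hf : ∀ i ∈ s, IsAff (f i)) :
    IsAffList fun a b c => s.map fun i => f i a b c := by
  induction s with
  | nil => exact .nil
  | cons i s ih =>
    simp only [List.map_cons]
    exact .cons (hf i (by simp)) (ih fun j hj => hf j (by simp [hj]))

theorem isAff_update {V : Type*} [DecidableEq V] {i j : V} (κ : V → R) (v : V) :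
    IsAff fun a b _ : R => Function.update (Function.update κ i a) j b v := by
  by_cases hj : v = j
  · subst hj
    simpa using isAff_snd
  by_cases hi : v = i
  · subst hi
    simpa [Function.update_of_ne hj] using isAff_fst
  · simpa [Function.update_of_ne hj, Function.update_of_ne hi] using
      IsCst.isAff ⟨κ v, fun _ _ _ => rfl⟩

end Affine

theorem isCst_update {R V : Type*} [DecidableEq V] {i j v : V} (κ : V → R) (hi : v ≠ i)
    (hj : v ≠ j) :
    IsCst fun a b _ : R => Function.update (Function.update κ i a) j b v :=
  ⟨κ v, fun a b _ => by simp [Function.update_of_ne hj, Function.update_of_ne hi]⟩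

/-- Replacing the product of two coordinates of a uniform vector by a random element. -/
theorem abs_expect_mul_sub_le {𝓖 : PrimeOrderGroupFamily} {k : ℕ} {A : PolySizeDistinguisher}
    {L : ℕ} {B : ℝ}
    (hB : ∀ σ : List (ZMod (𝓖.q k) × ZMod (𝓖.q k) × ZMod (𝓖.q k) × ZMod (𝓖.q k)),
      σ.length ≤ L → 𝓖.affAdvantage k A σ ≤ B)
    {V : Type*} [Fintype V] [DecidableEq V] {i j : V} (hij : i ≠ j)
    (F : (V → ZMod (𝓖.q k)) → ZMod (𝓖.q k) → List (ZMod (𝓖.q k)))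
    (hL : ∀ κ c, (F κ c).length ≤ L)
    (hF : ∀ κ, IsAffList fun a b c => F (Function.update (Function.update κ i a) j b) c) :
    |𝔼 κ, 𝓖.acceptProb k A (F κ (κ i * κ j)) - 𝔼 κ, 𝔼 c, 𝓖.acceptProb k A (F κ c)| ≤ B := by
  have hup (f : (V → ZMod (𝓖.q k)) → ℝ) :
      𝔼 κ, f κ = 𝔼 κ, 𝔼 a, 𝔼 b, f (Function.update (Function.update κ i a) j b) := by
    rw [← expect_update j f, ← expect_update i]
  rw [hup, hup fun κ => 𝔼 c, 𝓖.acceptProb k A (F κ c)]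
  -- With the coordinates other than `i` and `j` fixed, the rest is a DDH instance with known
  -- coefficients, so the bound holds pointwise.
  refine abs_expect_sub_expect_le fun κ => ?_
  obtain ⟨σ, hσ⟩ := hF κ
  replace hσ (a b c) : F (Function.update (Function.update κ i a) j b) c = affEval σ a b c :=
    hσ a b c
  simp only [hσ, Function.update_self, Function.update_of_ne hij]
  refine hB σ ?_
  -- The length of `σ` is read off from the value of `F` at an arbitrary point.
  have := hL (Function.update (Function.update κ i 0) j 0) 0
  rwa [hσ, affEval, List.length_map] at this

/-! ### Key slots -/

namespace RunSchedule

variable (S : RunSchedule) (k : ℕ)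

/-- The key pairs that are drawn: `inl (t, i)` is the new pair of user `i` for run `t` and `inr t`
is the pair that the controller draws in run `t`. -/
abbrev Slot : Type := Fin (S.runs k) × Fin (S.users k) ⊕ Fin (S.runs k)

/-- The key pair that user `i` holds at the start of run `t`. -/
def slot : (t : ℕ) → t < S.runs k → Fin (S.users k) → S.Slot k
  | 0, h, i => .inl (⟨0, h⟩, i)
  | t + 1, h, i =>
    if S.renew k (t + 1) i = true then .inl (⟨t + 1, h⟩, i)
    else if i = S.controller k t then .inr ⟨t, Nat.lt_of_succ_lt h⟩
    else slot t (Nat.lt_of_succ_lt h) i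

variable {S k}

/-- The user who draws a key pair. -/
def Slot.owner : S.Slot k → Fin (S.users k)
  | .inl x => x.2
  | .inr t => S.controller k t

/-- The first run in which a key pair can be used. -/
def Slot.birth : S.Slot k → ℕ
  | .inl x => x.1
  | .inr t => t + 1

theorem owner_slot (t : ℕ) (h : t < S.runs k) (i : Fin (S.users k)) :
    (S.slot k t h i).owner = i := by
  induction t with
  | zero => rfl
  | succ t ih =>
    rw [slot]
    split_ifs with h₁ h₂
    · rfl
    · exact h₂.symm
    · exact ih _

theorem birth_slot_le (t : ℕ) (h : t < S.runs k) (i : Fin (S.users k)) :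
    (S.slot k t h i).birth ≤ t := by
  induction t with
  | zero => exact le_rfl
  | succ t ih =>
    rw [slot]
    split_ifs with h₁ h₂
    · exact le_rfl
    · exact le_rfl
    · exact (ih _).trans t.le_succ

/-- The controller replaces his pair in run `s`, and later renewals only make it younger. -/
theorem lt_birth_slot_controller {s t : ℕ} (hst : s < t) (h : t < S.runs k) :
    s < (S.slot k t h (S.controller k s)).birth := by
  induction t with
  | zero => omega
  | succ t ih =>
    rw [slot]
    split_ifs with h₁ h₂
    · exact hst
    · exact hst
    · refine ih (lt_of_le_of_ne (Nat.lt_succ_iff.1 hst) ?_) _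
      rintro rfl
      exact h₂ rfl

theorem slot_injective (t : ℕ) (h : t < S.runs k) : Function.Injective (S.slot k t h) := by
  intro i j hij
  rw [← owner_slot t h i, hij, owner_slot]

/-- The keys of the controller of a run are not used after the run. -/
theorem slot_controller_ne {s t : ℕ} (hst : s < t) (hs : s < S.runs k) (ht : t < S.runs k)
    (i : Fin (S.users k)) : S.slot k s hs (S.controller k s) ≠ S.slot k t ht i := by
  intro he
  obtain rfl : S.controller k s = i := by
    rw [← owner_slot s hs (S.controller k s), he, owner_slot]
  have := lt_birth_slot_controller hst ht
  rw [← he] at this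
  exact this.not_ge (birth_slot_le _ _ _)

theorem slot_ne_inr {s t : ℕ} (hst : s ≤ t) (hs : s < S.runs k) (ht : t < S.runs k)
    (i : Fin (S.users k)) : S.slot k s hs i ≠ .inr ⟨t, ht⟩ := by
  intro he
  have := birth_slot_le s hs i
  rw [he] at this
  simp only [Slot.birth] at this
  omega

variable (S k)

/-- The last run. -/
def last : Fin (S.runs k) := ⟨S.runs k - 1, Nat.sub_one_lt_of_lt (S.one_le_runs k)⟩

/-- The controller of the last run. -/
def lastController : Fin (S.users k) := S.controller k (S.last k)

/-- The key pair that user `i` holds at the start of the last run. -/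
def lastSlot (i : Fin (S.users k)) : S.Slot k := S.slot k (S.last k) (S.last k).isLt i

/-- The key pair that user `i` holds after the last run. -/
def finalSlot (i : Fin (S.users k)) : S.Slot k :=
  if i = S.lastController k then .inr (S.last k) else S.lastSlot k i

variable {S k}

theorem lt_last {t : Fin (S.runs k)} (ht : t ≠ S.last k) : (t : ℕ) < S.last k := by
  have := t.isLt
  rw [Ne, Fin.ext_iff] at ht
  simp only [last] at ht ⊢
  omega

theorem lastSlot_injective : Function.Injective (S.lastSlot k) := slot_injective _ _

theorem lastSlot_ne_inr (i : Fin (S.users k)) : S.lastSlot k i ≠ .inr (S.last k) :=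
  slot_ne_inr le_rfl _ _ _

theorem slot_controller_ne_lastSlot {t : Fin (S.runs k)} (ht : t ≠ S.last k)
    (i : Fin (S.users k)) : S.slot k t t.isLt (S.controller k t) ≠ S.lastSlot k i :=
  slot_controller_ne (lt_last ht) _ _ _

theorem slot_controller_ne_finalSlot {t : Fin (S.runs k)} (ht : t ≠ S.last k)
    (i : Fin (S.users k)) : S.slot k t t.isLt (S.controller k t) ≠ S.finalSlot k i := by
  unfold finalSlot
  split_ifs
  · exact slot_ne_inr (lt_last ht).le _ _ _
  · exact slot_controller_ne_lastSlot ht i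

/-- The two factors of a mask are thus independent keys, and `finalSlot_injective` gives different
users different second factors. -/
theorem finalSlot_ne_lastSlot (i : Fin (S.users k)) :
    S.finalSlot k i ≠ S.lastSlot k (S.lastController k) := by
  unfold finalSlot
  split_ifs with h
  · exact (lastSlot_ne_inr _).symm
  · exact fun he => h (lastSlot_injective he)

theorem finalSlot_injective : Function.Injective (S.finalSlot k) := by
  intro i j hij
  unfold finalSlot at hij
  split_ifs at hij with hi hj hj
  · rw [hi, hj]
  · exact absurd hij.symm (lastSlot_ne_inr _)
  · exact absurd hij (lastSlot_ne_inr _)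
  · exact lastSlot_injective hij

end RunSchedule

/-! ### Exponents of the messages -/

namespace PrimeOrderGroupFamily

variable (𝓖 : PrimeOrderGroupFamily) {k n : ℕ}

/-- Exponents of the messages sent before the broadcast, in Protocol 1 if `p` is true and in
Protocol 2 otherwise. -/
def publicExps (p : Bool) (c : Fin n) (keys : Fin n → 𝓖.KeyPair k) : List (ZMod (𝓖.q k)) :=
  match p with
  | true => ((others c).flatMap fun i => [(keys i).1, (keys i).2]) ++
      (others c).map fun i => 𝓖.partialSum k n c i keys
  | false => ((others c).map fun i => (keys i).1) ++
      (others c).map fun i => 𝓖.partialSum k n c i keys - (keys i).2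

/-- Exponents of the last part of the broadcast. -/
def controllerExps (p : Bool) (c : Fin n) (keys : Fin n → 𝓖.KeyPair k) : List (ZMod (𝓖.q k)) :=
  match p with
  | true => [(keys c).1, (keys c).2]
  | false => [(keys c).1]

/-- Exponents of the messages of a run in which the `Y_i` have the exponents `Y i`. -/
def runExps (p : Bool) (c : Fin n) (keys : Fin n → 𝓖.KeyPair k) (Y : Fin n → ZMod (𝓖.q k)) :
    List (ZMod (𝓖.q k)) :=
  𝓖.publicExps p c keys ++ (List.finRange n).map Y ++ 𝓖.controllerExps p c keys

/-- Exponent of the common key. -/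
def keyExp (c : Fin n) (keys : Fin n → 𝓖.KeyPair k) : ZMod (𝓖.q k) :=
  (keys c).1 * ∑ j ∈ Finset.univ.filter (fun j => j ≠ c), (keys j).1

/-- Exponent of the unmasked `Y_i`. -/
def baseExp (c : Fin n) (keys : Fin n → 𝓖.KeyPair k) (new : 𝓖.KeyPair k) (i : Fin n) :
    ZMod (𝓖.q k) :=
  if i = c then 𝓖.keyExp c keys - (keys c).1 * new.1
  else (keys c).1 * 𝓖.partialSum k n c i keys

/-- The exponent that masks `Y_i`. -/
def maskExp (p : Bool) (c : Fin n) (keys : Fin n → 𝓖.KeyPair k) (new : 𝓖.KeyPair k) (i : Fin n) :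
    ZMod (𝓖.q k) :=
  (bif p then (keys c).2 else (keys c).1) * (if i = c then new else keys i).2

/-- Protocol 1 if `p` is true and Protocol 2 otherwise. -/
def protocolOf (p : Bool) : 𝓖.Protocol := bif p then 𝓖.protocol1 else 𝓖.protocol2

/-- In this form both protocols are treated at once: they differ only in the public messages and in
which controller key enters the masks. -/
theorem protocolOf_eq (p : Bool) (c : Fin n) (keys : Fin n → 𝓖.KeyPair k) (new : 𝓖.KeyPair k) :
    𝓖.protocolOf p k n c keys new =
      ((𝓖.runExps p c keys fun i =>
        𝓖.baseExp c keys new i - 𝓖.maskExp p c keys new i).map (𝓖.expo k),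
      𝓖.expo k (𝓖.keyExp c keys)) := by
  cases p
  · refine Prod.ext ?_ rfl
    simp only [protocolOf, cond_false, protocol2, runExps, publicExps, controllerExps,
      List.map_append, List.map_map, List.map_cons, List.map_nil]
    congr 3
    · refine List.map_congr_left fun i _ => ?_
      simp only [Function.comp, ← expo_add, sub_eq_add_neg]
    · funext i
      simp only [Function.comp, commonKey, baseExp, maskExp, keyExp, ← expo_add, cond_false]
      split_ifs <;> congr 1 <;> ring
  · refine Prod.ext ?_ rfl
    simp only [protocolOf, cond_true, protocol1, runExps, publicExps, controllerExps,
      List.map_append, List.map_map, List.map_cons, List.map_nil, List.map_flatMap]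
    congr 3
    funext i
    simp only [Function.comp, commonKey, baseExp, maskExp, keyExp, ← expo_add, cond_true]
    split_ifs <;> congr 1 <;> ring

theorem length_runExps_le (p : Bool) (c : Fin n) (keys : Fin n → 𝓖.KeyPair k)
    (Y : Fin n → ZMod (𝓖.q k)) : (𝓖.runExps p c keys Y).length ≤ 4 * n + 2 := by
  have h : (others c).length ≤ n := by
    simpa [others] using List.length_filter_le (fun i => decide (i ≠ c)) (List.finRange n)
  cases p <;> simp [runExps, publicExps, controllerExps, List.length_flatMap] <;> omega

/-- Isolates a single Diffie–Hellman product inside the key. -/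
theorem keyExp_eq {c u : Fin n} (hu : u ≠ c) (keys : Fin n → 𝓖.KeyPair k) :
    𝓖.keyExp c keys = (keys c).1 * (keys u).1 + (keys c).1 * 𝓖.partialSum k n c u keys := by
  have : Finset.univ.filter (fun j => j ≠ c) =
      insert u (Finset.univ.filter fun j => j ≠ c ∧ j ≠ u) := by
    ext j
    by_cases h : j = u <;> simp [h, hu]
  rw [keyExp, partialSum, this, Finset.sum_insert (by simp), mul_add]

variable (S : RunSchedule)

/-- The key pair in a slot, if `κ` consists of all the private keys. -/
def pairAt (κ : S.Slot k × Bool → ZMod (𝓖.q k)) (s : S.Slot k) : 𝓖.KeyPair k :=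
  (κ (s, false), κ (s, true))

/-- The randomness of the users as a vector of exponents. -/
def coinsEquiv (k : ℕ) : (S.Slot k × Bool → ZMod (𝓖.q k)) ≃ 𝓖.RunCoins S k where
  toFun κ := (fun t i => 𝓖.pairAt S κ (.inl (t, i)), fun t => 𝓖.pairAt S κ (.inr t))
  invFun ω v :=
    let x := Sum.elim (fun y => ω.1 y.1 y.2) ω.2 v.1
    bif v.2 then x.2 else x.1
  left_inv κ := by
    funext ⟨s, b⟩
    rcases s with s | s <;> cases b <;> rfl
  right_inv ω := rfl

theorem keysAt_coinsEquiv (κ : S.Slot k × Bool → ZMod (𝓖.q k)) (t : ℕ) (h : t < S.runs k)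
    (i : Fin (S.users k)) :
    𝓖.keysAt S k (𝓖.coinsEquiv S k κ) t h i = 𝓖.pairAt S κ (S.slot k t h i) := by
  induction t with
  | zero => rfl
  | succ t ih =>
    rw [keysAt, RunSchedule.slot, ih]
    split_ifs <;> rfl

/-- The keys of all the users at the start of run `t`. -/
def pairsAt (κ : S.Slot k × Bool → ZMod (𝓖.q k)) (t : Fin (S.runs k)) :
    Fin (S.users k) → 𝓖.KeyPair k :=
  fun i => 𝓖.pairAt S κ (S.slot k t t.isLt i)

/-- The exponents of the unmasked `Y_i` in run `t`. -/
def runBase (κ : S.Slot k × Bool → ZMod (𝓖.q k)) (t : Fin (S.runs k)) :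
    Fin (S.users k) → ZMod (𝓖.q k) :=
  𝓖.baseExp (S.controller k t) (𝓖.pairsAt S κ t) (𝓖.pairAt S κ (.inr t))

/-- The exponents that mask the `Y_i` in run `t`. -/
def runMask (p : Bool) (κ : S.Slot k × Bool → ZMod (𝓖.q k)) (t : Fin (S.runs k)) :
    Fin (S.users k) → ZMod (𝓖.q k) :=
  𝓖.maskExp p (S.controller k t) (𝓖.pairsAt S κ t) (𝓖.pairAt S κ (.inr t))

/-- Exponents of all the messages, if the `Y_i` of the last run have the exponents `Y i`. -/
def transcriptExps (p : Bool) (κ : S.Slot k × Bool → ZMod (𝓖.q k))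
    (Y : Fin (S.users k) → ZMod (𝓖.q k)) : List (ZMod (𝓖.q k)) :=
  (List.finRange (S.runs k)).flatMap fun t : Fin (S.runs k) =>
    𝓖.runExps p (S.controller k t) (𝓖.pairsAt S κ t) fun i =>
      if t = S.last k then Y i else 𝓖.runBase S κ t i - 𝓖.runMask S p κ t i

/-- Exponent of the key of the last run. -/
def lastKeyExp (κ : S.Slot k × Bool → ZMod (𝓖.q k)) : ZMod (𝓖.q k) :=
  𝓖.keyExp (S.lastController k) (𝓖.pairsAt S κ (S.last k))

theorem length_transcriptExps_le (p : Bool) (κ : S.Slot k × Bool → ZMod (𝓖.q k))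
    (Y : Fin (S.users k) → ZMod (𝓖.q k)) :
    (𝓖.transcriptExps S p κ Y).length ≤ S.runs k * (4 * S.users k + 2) := by
  rw [transcriptExps, List.length_flatMap]
  refine (List.sum_le_card_nsmul _ (4 * S.users k + 2) ?_).trans (by simp)
  intro x hx
  obtain ⟨t, -, rfl⟩ := List.mem_map.1 hx
  exact 𝓖.length_runExps_le p _ _ _

theorem runAt_coinsEquiv (p : Bool) (κ : S.Slot k × Bool → ZMod (𝓖.q k)) (t : Fin (S.runs k)) :
    𝓖.runAt (𝓖.protocolOf p) S k (𝓖.coinsEquiv S k κ) t =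
      ((𝓖.runExps p (S.controller k t) (𝓖.pairsAt S κ t) fun i =>
        𝓖.runBase S κ t i - 𝓖.runMask S p κ t i).map (𝓖.expo k),
      𝓖.expo k (𝓖.keyExp (S.controller k t) (𝓖.pairsAt S κ t))) := by
  have : 𝓖.keysAt S k (𝓖.coinsEquiv S k κ) t t.isLt = 𝓖.pairsAt S κ t :=
    funext fun i => 𝓖.keysAt_coinsEquiv S κ t t.isLt i
  rw [runAt, protocolOf_eq, this]
  rfl

theorem transcript_coinsEquiv (p : Bool) (κ : S.Slot k × Bool → ZMod (𝓖.q k)) :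
    𝓖.transcript (𝓖.protocolOf p) S k (𝓖.coinsEquiv S k κ) =
      (𝓖.transcriptExps S p κ fun i =>
        𝓖.runBase S κ (S.last k) i - 𝓖.runMask S p κ (S.last k) i).map (𝓖.expo k) := by
  simp only [transcript, runAt_coinsEquiv, transcriptExps, List.map_flatMap]
  congr 1
  funext t
  congr 2
  funext i
  split_ifs with h
  · rw [h]
  · rfl

theorem lastKey_coinsEquiv (p : Bool) (κ : S.Slot k × Bool → ZMod (𝓖.q k)) :
    𝓖.lastKey (𝓖.protocolOf p) S k (𝓖.coinsEquiv S k κ) = 𝓖.expo k (𝓖.lastKeyExp S κ) := by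
  rw [lastKey, runAt_coinsEquiv]
  rfl

/-- The flag `p` serves also as the key component: Protocol 1 masks with the second key of the
controller, Protocol 2 with the first. `finalSlot` absorbs the exceptional `x'_c` in `Y_c`. -/
theorem runMask_last (p : Bool) (κ : S.Slot k × Bool → ZMod (𝓖.q k)) (i : Fin (S.users k)) :
    𝓖.runMask S p κ (S.last k) i =
      κ (S.lastSlot k (S.lastController k), p) * κ (S.finalSlot k i, true) := by
  unfold runMask maskExp RunSchedule.finalSlot RunSchedule.lastController
  congr 1
  · cases p <;> rfl
  · split_ifs <;> rfl

end PrimeOrderGroupFamily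

namespace PrimeOrderGroupFamily

variable (𝓖 : PrimeOrderGroupFamily) {k n : ℕ} (S : RunSchedule)

/-! ### Messages as affine functions of two unknown keys. -/

section Affine

variable {I J : S.Slot k × Bool} (κ : S.Slot k × Bool → ZMod (𝓖.q k))

theorem isAff_pairAt_fst (s : S.Slot k) : IsAff fun a b _ =>
    (𝓖.pairAt S (Function.update (Function.update κ I a) J b) s).1 :=
  isAff_update κ _

theorem isAff_pairAt_snd (s : S.Slot k) : IsAff fun a b _ =>
    (𝓖.pairAt S (Function.update (Function.update κ I a) J b) s).2 :=
  isAff_update κ _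

theorem isCst_pairAt_fst {s : S.Slot k} (hI : (s, false) ≠ I) (hJ : (s, false) ≠ J) :
    IsCst fun a b (_ : ZMod (𝓖.q k)) =>
      (𝓖.pairAt S (Function.update (Function.update κ I a) J b) s).1 :=
  isCst_update κ hI hJ

theorem isCst_pairAt_snd {s : S.Slot k} (hI : (s, true) ≠ I) (hJ : (s, true) ≠ J) :
    IsCst fun a b (_ : ZMod (𝓖.q k)) =>
      (𝓖.pairAt S (Function.update (Function.update κ I a) J b) s).2 :=
  isCst_update κ hI hJ

theorem isAff_partialSum (t : Fin (S.runs k)) (c i : Fin (S.users k)) : IsAff fun a b _ =>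
    𝓖.partialSum k (S.users k) c i
      (𝓖.pairsAt S (Function.update (Function.update κ I a) J b) t) :=
  .sum _ fun _ _ => 𝓖.isAff_pairAt_fst S κ _

theorem isAffList_publicExps (p : Bool) (t : Fin (S.runs k)) (c : Fin (S.users k)) :
    IsAffList fun a b _ => 𝓖.publicExps p c
      (𝓖.pairsAt S (Function.update (Function.update κ I a) J b) t) := by
  cases p
  · exact (IsAffList.map _ fun _ _ => 𝓖.isAff_pairAt_fst S κ _).append
      (.map _ fun _ _ => (𝓖.isAff_partialSum S κ t c _).sub (𝓖.isAff_pairAt_snd S κ _))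
  · exact (IsAffList.flatMap _ fun _ _ => .cons (𝓖.isAff_pairAt_fst S κ _)
      (.cons (𝓖.isAff_pairAt_snd S κ _) .nil)).append (.map _ fun _ _ =>
        𝓖.isAff_partialSum S κ t c _)

theorem isAffList_controllerExps (p : Bool) (t : Fin (S.runs k)) (c : Fin (S.users k)) :
    IsAffList fun a b _ => 𝓖.controllerExps p c
      (𝓖.pairsAt S (Function.update (Function.update κ I a) J b) t) := by
  cases p
  · exact .cons (𝓖.isAff_pairAt_fst S κ _) .nil
  · exact .cons (𝓖.isAff_pairAt_fst S κ _) (.cons (𝓖.isAff_pairAt_snd S κ _) .nil)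

/-- If the keys of the controller are constant, then the exponents `Y_i` are affine. -/
theorem isAff_runBase_sub_runMask (p : Bool) {t : Fin (S.runs k)}
    (hI : S.slot k t t.isLt (S.controller k t) ≠ I.1)
    (hJ : S.slot k t t.isLt (S.controller k t) ≠ J.1) (i : Fin (S.users k)) : IsAff fun a b _ =>
      𝓖.runBase S (Function.update (Function.update κ I a) J b) t i -
        𝓖.runMask S p (Function.update (Function.update κ I a) J b) t i := by
  have h₁ := 𝓖.isCst_pairAt_fst S κ (I := I) (J := J) (fun h => hI (congrArg Prod.fst h))
    fun h => hJ (congrArg Prod.fst h)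
  have h₂ := 𝓖.isCst_pairAt_snd S κ (I := I) (J := J) (fun h => hI (congrArg Prod.fst h))
    fun h => hJ (congrArg Prod.fst h)
  refine IsAff.sub ?_ ?_
  · unfold runBase baseExp
    split_ifs
    · exact (h₁.mul_isAff (.sum _ fun _ _ => 𝓖.isAff_pairAt_fst S κ _)).sub
        (h₁.mul_isAff (𝓖.isAff_pairAt_fst S κ _))
    · exact h₁.mul_isAff (𝓖.isAff_partialSum S κ t _ _)
  · unfold runMask maskExp
    have h₃ : IsAff fun a b _ => (if i = S.controller k t then
        𝓖.pairAt S (Function.update (Function.update κ I a) J b) (.inr t) else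
        𝓖.pairsAt S (Function.update (Function.update κ I a) J b) t i).2 := by
      split_ifs
      · exact 𝓖.isAff_pairAt_snd S κ _
      · exact 𝓖.isAff_pairAt_snd S κ _
    cases p
    · exact h₁.mul_isAff h₃
    · exact h₂.mul_isAff h₃

/-- Outside the `Y_i` all exponents are linear in the keys. In earlier runs the products in `Y_i`
have a controller key as a factor, which `hI` and `hJ` make constant. -/
theorem isAffList_transcriptExps (p : Bool)
    (hI : ∀ t : Fin (S.runs k), t ≠ S.last k → S.slot k t t.isLt (S.controller k t) ≠ I.1)
    (hJ : ∀ t : Fin (S.runs k), t ≠ S.last k → S.slot k t t.isLt (S.controller k t) ≠ J.1)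
    {Y : ZMod (𝓖.q k) → ZMod (𝓖.q k) → ZMod (𝓖.q k) → Fin (S.users k) → ZMod (𝓖.q k)}
    (hY : ∀ i, IsAff fun a b c => Y a b c i) : IsAffList fun a b c =>
      𝓖.transcriptExps S p (Function.update (Function.update κ I a) J b) (Y a b c) := by
  refine .flatMap _ fun t _ => ?_
  refine ((𝓖.isAffList_publicExps S κ p t _).append (.map _ fun i _ => ?_)).append
    (𝓖.isAffList_controllerExps S κ p t _)
  split_ifs with h
  · exact hY i
  · exact 𝓖.isAff_runBase_sub_runMask S κ p (hI t h) (hJ t h) i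

/-- The second unknown is an `x`-key and the `r_j` with `j ≠ c` lie in other slots, so only `r_c`
can vary. -/
theorem isAff_lastKeyExp {p : Bool} {s : S.Slot k} : IsAff fun a b _ => 𝓖.lastKeyExp S
    (Function.update (Function.update κ (S.lastSlot k (S.lastController k), p) a) (s, true) b) := by
  refine (𝓖.isAff_pairAt_fst S κ _).mul_isCst (.sum _ fun j hj => ?_)
  refine 𝓖.isCst_pairAt_fst S κ (fun h => ?_) (by simp)
  exact (Finset.mem_filter.1 hj).2 (RunSchedule.lastSlot_injective (congrArg Prod.fst h))

theorem isAff_runBase_last {p : Bool} {s : S.Slot k} (i : Fin (S.users k)) :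
    IsAff fun a b _ => 𝓖.runBase S (Function.update
      (Function.update κ (S.lastSlot k (S.lastController k), p) a) (s, true) b) (S.last k) i := by
  unfold runBase baseExp
  split_ifs
  · refine (𝓖.isAff_lastKeyExp S κ).sub ((𝓖.isAff_pairAt_fst S κ _).mul_isCst ?_)
    refine 𝓖.isCst_pairAt_fst S κ (fun h => ?_) (by simp)
    exact RunSchedule.lastSlot_ne_inr _ (congrArg Prod.fst h).symm
  · refine (𝓖.isAff_pairAt_fst S κ _).mul_isCst (.sum _ fun j hj => ?_)
    refine 𝓖.isCst_pairAt_fst S κ (fun h => ?_) (by simp)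
    exact (Finset.mem_filter.1 hj).2.1 (RunSchedule.lastSlot_injective (congrArg Prod.fst h))

end Affine

/-! ### Hybrid argument for the last run. -/

section Hybrids

variable {S} {𝓖} {A : PolySizeDistinguisher} {B : ℝ} (p : Bool)
  (hB : ∀ σ : List (ZMod (𝓖.q k) × ZMod (𝓖.q k) × ZMod (𝓖.q k) × ZMod (𝓖.q k)),
    σ.length ≤ S.runs k * (4 * S.users k + 2) + 1 → 𝓖.affAdvantage k A σ ≤ B)

/-- Exponents of the `Y_i` of the last run if the users in `s` have a random mask. -/
def hybridExps (S : RunSchedule) (s : Finset (Fin (S.users k)))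
    (z : Fin (S.users k) → ZMod (𝓖.q k)) (κ : S.Slot k × Bool → ZMod (𝓖.q k))
    (i : Fin (S.users k)) : ZMod (𝓖.q k) :=
  𝓖.runBase S κ (S.last k) i - if i ∈ s then z i else 𝓖.runMask S p κ (S.last k) i

include hB

/-- Replacing the mask of one more user by a random one. -/
theorem abs_hybrid_insert_sub_le {ch : (S.Slot k × Bool → ZMod (𝓖.q k)) → ZMod (𝓖.q k)}
    (hch : ∀ κ s, IsAff fun a b _ => ch (Function.update (Function.update κ
      (S.lastSlot k (S.lastController k), p) a) (s, true) b))
    {s : Finset (Fin (S.users k))} {i : Fin (S.users k)} (hi : i ∉ s) :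
    |𝔼 z, 𝔼 κ, 𝓖.acceptProb k A (𝓖.transcriptExps S p κ (hybridExps p S s z κ) ++ [ch κ]) -
      𝔼 z, 𝔼 κ, 𝓖.acceptProb k A
        (𝓖.transcriptExps S p κ (hybridExps p S (insert i s) z κ) ++ [ch κ])| ≤ B := by
  let F (z : Fin (S.users k) → ZMod (𝓖.q k)) (κ : S.Slot k × Bool → ZMod (𝓖.q k))
      (c : ZMod (𝓖.q k)) : List (ZMod (𝓖.q k)) :=
    𝓖.transcriptExps S p κ (fun j => 𝓖.runBase S κ (S.last k) j - if j = i then c else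
      if j ∈ s then z j else 𝓖.runMask S p κ (S.last k) j) ++ [ch κ]
  have hreal (z κ) : 𝓖.transcriptExps S p κ (hybridExps p S s z κ) ++ [ch κ] =
      F z κ (κ (S.lastSlot k (S.lastController k), p) * κ (S.finalSlot k i, true)) := by
    simp only [F]
    congr 2
    funext j
    rw [hybridExps]
    by_cases hj : j = i
    · subst hj
      rw [if_neg hi, if_pos rfl, runMask_last]
    · rw [if_neg hj]
  have hrand (z κ c) : 𝓖.transcriptExps S p κ
      (hybridExps p S (insert i s) (Function.update z i c) κ) ++ [ch κ] = F z κ c := by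
    simp only [F]
    congr 2
    funext j
    rw [hybridExps]
    by_cases hj : j = i
    · subst hj
      simp
    · simp [hj]
  -- The new random mask `z i` is drawn separately, to play the part of the random `c` in DDH.
  rw [← expect_update i fun z => 𝔼 κ, 𝓖.acceptProb k A (𝓖.transcriptExps S p κ
    (hybridExps p S (insert i s) z κ) ++ [ch κ])]
  refine abs_expect_sub_expect_le fun z => ?_
  rw [Finset.expect_comm]
  simp only [hreal, hrand]
  refine abs_expect_mul_sub_le hB ?_ (F z) (fun κ c => ?_) fun κ => ?_
  · exact fun h => RunSchedule.finalSlot_ne_lastSlot i (congrArg Prod.fst h).symm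
  · simpa [F] using 𝓖.length_transcriptExps_le S p κ _
  · refine (𝓖.isAffList_transcriptExps S κ p
      (fun t ht => RunSchedule.slot_controller_ne_lastSlot ht _)
      (fun t ht => RunSchedule.slot_controller_ne_finalSlot ht _) fun j => ?_).append
      (.cons (hch κ _) .nil)
    refine (𝓖.isAff_runBase_last S κ j).sub ?_
    split_ifs with h₁ h₂
    · exact isAff_thd
    · exact IsCst.isAff ⟨z j, fun _ _ _ => rfl⟩
    -- The remaining masks share the unknown controller key, but their second factors are keys other
    -- than `b`.
    · simp only [runMask_last]
      refine (isAff_update κ _).mul_isCst (isCst_update κ (fun h => ?_) fun h => ?_)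
      · exact RunSchedule.finalSlot_ne_lastSlot j (congrArg Prod.fst h)
      · exact h₁ (RunSchedule.finalSlot_injective (congrArg Prod.fst h))

/-- Replacing all the `Y_i` of the last run by random elements. -/
theorem abs_real_sub_random_le {ch : (S.Slot k × Bool → ZMod (𝓖.q k)) → ZMod (𝓖.q k)}
    (hch : ∀ κ s, IsAff fun a b _ => ch (Function.update (Function.update κ
      (S.lastSlot k (S.lastController k), p) a) (s, true) b)) :
    |𝔼 κ, 𝓖.acceptProb k A (𝓖.transcriptExps S p κ (fun i =>
        𝓖.runBase S κ (S.last k) i - 𝓖.runMask S p κ (S.last k) i) ++ [ch κ]) -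
      𝔼 z, 𝔼 κ, 𝓖.acceptProb k A (𝓖.transcriptExps S p κ z ++ [ch κ])| ≤ S.users k * B := by
  have key (s : Finset (Fin (S.users k))) :
      |𝔼 z, 𝔼 κ, 𝓖.acceptProb k A (𝓖.transcriptExps S p κ (hybridExps p S ∅ z κ) ++ [ch κ]) -
        𝔼 z, 𝔼 κ, 𝓖.acceptProb k A (𝓖.transcriptExps S p κ (hybridExps p S s z κ) ++ [ch κ])| ≤
          s.card * B := by
    induction s using Finset.induction_on with
    | empty => simp
    | insert i s hi ih =>
      refine (abs_sub_le _ _ _).trans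
        ((add_le_add ih (abs_hybrid_insert_sub_le p hB hch hi)).trans_eq ?_)
      rw [Finset.card_insert_of_notMem hi]
      push_cast
      ring
  have hempty (κ) (z : Fin (S.users k) → ZMod (𝓖.q k)) : hybridExps p S ∅ z κ = fun i =>
      𝓖.runBase S κ (S.last k) i - 𝓖.runMask S p κ (S.last k) i := by
    funext i
    simp [hybridExps]
  -- With all masks random, `Y` is the base minus `z`, a bijection in `z` for each `κ`; hence `Y` is
  -- uniform and independent of `κ`.
  have huniv (κ) (z : Fin (S.users k) → ZMod (𝓖.q k)) : hybridExps p S Finset.univ z κ =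
      Equiv.subLeft (𝓖.runBase S κ (S.last k)) z := by
    funext i
    simp [hybridExps]
  have h := key Finset.univ
  rw [Finset.expect_comm (f := fun z κ => 𝓖.acceptProb k A
    (𝓖.transcriptExps S p κ (hybridExps p S Finset.univ z κ) ++ [ch κ]))] at h
  simp only [hempty, huniv, Fintype.expect_const, Finset.card_univ, Fintype.card_fin] at h
  rw [Finset.expect_comm (f := fun z κ => 𝓖.acceptProb k A (𝓖.transcriptExps S p κ z ++ [ch κ]))]
  convert h using 4 with κ
  exact (Fintype.expect_equiv (Equiv.subLeft (𝓖.runBase S κ (S.last k))) _ _ fun _ => rfl).symm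

/-- If all the `Y_i` of the last run are random, then the key can be replaced by a random one. -/
theorem abs_lastKey_sub_random_le (z : Fin (S.users k) → ZMod (𝓖.q k)) :
    |𝔼 κ, 𝓖.acceptProb k A (𝓖.transcriptExps S p κ z ++ [𝓖.lastKeyExp S κ]) -
      𝔼 κ, 𝔼 w, 𝓖.acceptProb k A (𝓖.transcriptExps S p κ z ++ [w])| ≤ B := by
  have : Nontrivial (Fin (S.users k)) := Fin.nontrivial_iff_two_le.2 (S.two_le_users k)
  obtain ⟨u, hu⟩ := exists_ne (S.lastController k)
  -- The rest of the key involves neither `r_u` nor a second factor `r_c`. It is affine in the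
  -- unknowns, and as a shift it leaves a uniform exponent uniform.
  let r (κ : S.Slot k × Bool → ZMod (𝓖.q k)) : ZMod (𝓖.q k) :=
    κ (S.lastSlot k (S.lastController k), false) *
      𝓖.partialSum k (S.users k) (S.lastController k) u (𝓖.pairsAt S κ (S.last k))
  let F (κ : S.Slot k × Bool → ZMod (𝓖.q k)) (c : ZMod (𝓖.q k)) : List (ZMod (𝓖.q k)) :=
    𝓖.transcriptExps S p κ z ++ [c + r κ]
  have hreal (κ) : 𝓖.transcriptExps S p κ z ++ [𝓖.lastKeyExp S κ] =
      F κ (κ (S.lastSlot k (S.lastController k), false) * κ (S.lastSlot k u, false)) := by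
    rw [lastKeyExp, keyExp_eq _ hu]
    rfl
  have hrand (κ) : 𝔼 w, 𝓖.acceptProb k A (𝓖.transcriptExps S p κ z ++ [w]) =
      𝔼 c, 𝓖.acceptProb k A (F κ c) :=
    (Fintype.expect_equiv (Equiv.addRight (r κ)) _ _ fun _ => rfl).symm
  simp only [hreal, hrand]
  refine abs_expect_mul_sub_le hB ?_ F (fun κ c => ?_) fun κ => ?_
  · exact fun h => hu (RunSchedule.lastSlot_injective (congrArg Prod.fst h)).symm
  · simpa [F] using 𝓖.length_transcriptExps_le S p κ _
  · refine (𝓖.isAffList_transcriptExps S κ p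
      (fun t ht => RunSchedule.slot_controller_ne_lastSlot ht _)
      (fun t ht => RunSchedule.slot_controller_ne_lastSlot ht _)
      fun j => IsCst.isAff ⟨z j, fun _ _ _ => rfl⟩).append
      (.cons (isAff_thd.add ((isAff_update κ _).mul_isCst (.sum _ fun j hj => ?_))) .nil)
    obtain ⟨-, h₁, h₂⟩ := Finset.mem_filter.1 hj
    refine 𝓖.isCst_pairAt_fst S κ (fun h => h₁ ?_) fun h => h₂ ?_
    · exact RunSchedule.lastSlot_injective (congrArg Prod.fst h)
    · exact RunSchedule.lastSlot_injective (congrArg Prod.fst h)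

/-- The key of the last run is indistinguishable from a random element. -/
theorem abs_real_sub_ideal_le :
    |𝔼 κ, 𝓖.acceptProb k A (𝓖.transcriptExps S p κ (fun i =>
        𝓖.runBase S κ (S.last k) i - 𝓖.runMask S p κ (S.last k) i) ++ [𝓖.lastKeyExp S κ]) -
      𝔼 κ, 𝔼 w, 𝓖.acceptProb k A (𝓖.transcriptExps S p κ (fun i =>
        𝓖.runBase S κ (S.last k) i - 𝓖.runMask S p κ (S.last k) i) ++ [w])| ≤
      (2 * S.users k + 1) * B := by
  -- Randomize the `Y_i`, randomize the key, then restore the `Y_i` for each fixed challenge `w`: `n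
  -- + 1 + n` advantages.
  have h₁ := abs_real_sub_random_le p hB fun κ _ => 𝓖.isAff_lastKeyExp S κ
  have h₂ := abs_expect_sub_expect_le (abs_lastKey_sub_random_le p hB)
  have h₃ := abs_expect_sub_expect_le fun w : ZMod (𝓖.q k) =>
    abs_real_sub_random_le p hB (ch := fun _ => w) fun _ _ => IsCst.isAff ⟨w, fun _ _ _ => rfl⟩
  rw [Finset.expect_comm] at h₃
  have h₄ : 𝔼 w, 𝔼 z, 𝔼 κ, 𝓖.acceptProb k A (𝓖.transcriptExps S p κ z ++ [w]) =
      𝔼 z, 𝔼 κ, 𝔼 w, 𝓖.acceptProb k A (𝓖.transcriptExps S p κ z ++ [w]) := by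
    rw [Finset.expect_comm]
    exact Finset.expect_congr rfl fun z _ => Finset.expect_comm _ _ _
  rw [h₄] at h₃
  rw [abs_le] at *
  constructor <;> linarith

end Hybrids

/-! ### Secrecy -/

theorem acceptProb_eq_one_sub (A : PolySizeDistinguisher) (l : List (ZMod (𝓖.q k))) :
    (𝔼 ρ, if (A.output k (𝓖.encList k (l.map (𝓖.expo k))) ρ == false) = true then (1 : ℝ) else 0) =
      1 - 𝓖.acceptProb k A l := by
  rw [acceptProb, eq_sub_iff_add_eq, ← Finset.expect_add_distrib]
  refine (Finset.expect_congr rfl fun ρ _ => ?_).trans (Fintype.expect_const (1 : ℝ))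
  cases A.output k (𝓖.encList k (l.map (𝓖.expo k))) ρ <;> simp

/-- Conditioning on the bit `b` turns guessing into distinguishing: the excess over one half is half
the signed gap. -/
theorem guessProb_eq (p : Bool) (A : PolySizeDistinguisher) (k : ℕ) :
    𝓖.guessProb (𝓖.protocolOf p) S A k = 1 / 2 + (1 / 2) *
      (𝔼 κ, 𝓖.acceptProb k A (𝓖.transcriptExps S p κ (fun i =>
        𝓖.runBase S κ (S.last k) i - 𝓖.runMask S p κ (S.last k) i) ++ [𝓖.lastKeyExp S κ]) -
      𝔼 κ, 𝔼 w, 𝓖.acceptProb k A (𝓖.transcriptExps S p κ (fun i =>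
        𝓖.runBase S κ (S.last k) i - 𝓖.runMask S p κ (S.last k) i) ++ [w])) := by
  have hG (f : 𝓖.G k → ℝ) : 𝔼 x, f x = 𝔼 a, f (𝓖.expo k a) :=
    (Fintype.expect_bijective _ (𝓖.expo_bijective k) _ _ fun _ => rfl).symm
  have hω (f : 𝓖.RunCoins S k → ℝ) : 𝔼 ω, f ω = 𝔼 κ, f (𝓖.coinsEquiv S k κ) :=
    (Fintype.expect_equiv (𝓖.coinsEquiv S k) _ _ fun _ => rfl).symm
  have hb (f : Bool → ℝ) : 𝔼 b, f b = (1 / 2) * f true + (1 / 2) * f false := by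
    rw [Fintype.expect_eq_sum_div_card, Fintype.sum_bool, Fintype.card_bool]
    push_cast
    ring
  have hmap (l : List (ZMod (𝓖.q k))) (a : ZMod (𝓖.q k)) :
      l.map (𝓖.expo k) ++ [𝓖.expo k a] = (l ++ [a]).map (𝓖.expo k) := by simp
  rw [guessProb, unifProb_eq_expect, Fintype.expect_prod_type, hω]
  simp only [Fintype.expect_prod_type, hG, hb, transcript_coinsEquiv, lastKey_coinsEquiv, if_true,
    Bool.false_eq_true, if_false, hmap, acceptProb_eq_one_sub, Finset.expect_add_distrib,
    ← Finset.mul_expect, Finset.expect_sub_distrib, Fintype.expect_const]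
  simp only [beq_true, acceptProb]
  ring

theorem guaranteesSecrecy_protocolOf (hDDH : 𝓖.DDHIntractable) (p : Bool) :
    𝓖.GuaranteesSecrecy (𝓖.protocolOf p) := by
  intro S A
  have hn := S.users_poly
  obtain ⟨ε, hε, hB⟩ := hDDH.exists_negligible_bound A (L := fun k =>
    S.runs k * (4 * S.users k + 2) + 1)
    ((S.runs_poly.mul (((PolyBounded.const 4).mul hn).add (.const 2))).add (.const 1))
  refine ⟨fun k => (2 * S.users k + 1 : ℕ) * ε k,
    hε.polyBounded_mul (((PolyBounded.const 2).mul hn).add (.const 1)), fun k => ?_⟩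
  have h := abs_real_sub_ideal_le p (hB k)
  -- Nonnegativity of the bound allows the factor `1 / 2` to be dropped.
  have h' := (abs_nonneg _).trans h
  rw [guessProb_eq]
  push_cast
  linarith [le_of_abs_le h]

end PrimeOrderGroupFamily

theorem mainTheorem1 (𝓖 : PrimeOrderGroupFamily) (hDDH : 𝓖.DDHIntractable) :
    𝓖.GuaranteesSecrecy 𝓖.protocol1 ∧ 𝓖.GuaranteesSecrecy 𝓖.protocol2 :=
  ⟨𝓖.guaranteesSecrecy_protocolOf hDDH true, 𝓖.guaranteesSecrecy_protocolOf hDDH false⟩
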